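/- An \emph{ordered group} is a group $G$ with a linear order such that $a\le b$ implies $ag\le bg$ and $ga\le gb$ for all $a,b,g\in G$. For a linear order $X$, let $\mathbb{Z}^X$ be the set of finitely supported functions $X\to\mathbb{Z}$, ordered by $f<g$ iff $f(x)<g(x)$ at the largest $x\in X$ with $f(x)\ne g(x)$. Let $\mathbb{Z}^X\mathbb{Q}^0=\mathbb{Z}^X$, and let $\mathbb{Z}^X\mathbb{Q}^1=\mathbb{Z}^X\mathbb{Q}$ be the set of pairs $\langle f,q\rangle\in\mathbb{Z}^X\times\mathbb{Q}$, ordered by comparing first the rational coordinates and then, if these are equal, the coordinates in $\mathbb{Z}^X$. Consider the following two problems (partial multi-valued functions between represented spaces). \begin{itemize} \item $\mathsf{OG\mapsto\epsilon}$: the input is a countable ordered group $G$, presented on a set of natural numbers and named by the characteristic function of that set, the multiplication and the characteristic function of the order; the output is an $\epsilon\in\{0,1\}$ such that, for some well-order $\alpha$, $G$ is order-isomorphic to $\mathbb{Z}^{\alpha}\mathbb{Q}^{\epsilon}$. \item $\mathsf{WF}$: the input is a tree, i.e. a nonempty set $T\subseteq\mathbb{N}^{<\mathbb{N}}$ closed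 under initial segments, named by its characteristic function; the output is $0$ if $T$ has no infinite path and $1$ otherwise. \end{itemize} Here the name of a number $n\in\{0,1\}$ is the sequence $n,0,0,\ldots$ Then every countable ordered group $G$ has exactly one output $\epsilon$ under $\mathsf{OG\mapsto\epsilon}$, so that the problem is defined on all countable ordered groups, and $$\mathsf{OG\mapsto\epsilon}\ \equiv_{\mathsf{W}}\ \mathsf{WF},$$ that is, each of the two problems is Weihrauch reducible to the other. (A problem $f$ is Weihrauch reducible to a problem $g$ if there are computable partial functions $\Phi,\Psi$ on Baire space $\mathbb{N}^{\mathbb{N}}$ such that for every name $p$ of a point $x\in\mathrm{dom}(f)$, $\Phi(p)$ is a name of some $z\in\mathrm{dom}(g)$, and for every name $q$ of an element of $g(z)$, $\Psi(\langle p,q\rangle)$ is a name of an element of $f(x)$.) -/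

import Mathlib

/-! ### Computability on Baire space -/

/-- The initial segment `x(0), …, x(n-1)` of `x`. -/
def initSeg (x : ℕ → ℕ) (n : ℕ) : List ℕ :=
  (List.range n).map x

/-- A partial function `F` on Baire space is computable if some total computable function `g` on
finite strings, monotone for the prefix order, satisfies: `F(x) = y` if and only if every initial
segment of `y` is a prefix of `g` of some initial segment of `x`. -/
def IsComputableFunctional (F : (ℕ → ℕ) →. (ℕ → ℕ)) : Prop :=
  ∃ g : List ℕ → List ℕ, Computable g ∧
    (∀ σ τ, σ <+: τ → g σ <+: g τ) ∧
    ∀ x y, y ∈ F x ↔ ∀ n, ∃ m, initSeg y n <+: g (initSeg x m)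

/-- The pairing `⟨p, q⟩` on Baire space: `p` on the even and `q` on the odd positions. -/
def joinSeq (p q : ℕ → ℕ) : ℕ → ℕ :=
  fun n => if n % 2 = 0 then p (n / 2) else q (n / 2)

/-! ### Represented spaces, problems, Weihrauch reducibility -/

/-- A represented space. The relation `IsName p x` is the graph of a partial
surjection from Baire space onto `X`. -/
class RepresentedSpace (X : Type*) where
  IsName : (ℕ → ℕ) → X → Prop
  unique : ∀ {p x y}, IsName p x → IsName p y → x = y
  surj : ∀ x, ∃ p, IsName p x

open RepresentedSpace (IsName)

/-- A problem, that is, a partial multi-valued function from `X` to `Y`: a relation,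
given by the set of values at each point. -/
abbrev Problem (X Y : Type*) := X → Set Y

/-- The domain of a problem. -/
def Problem.dom {X Y : Type*} (f : Problem X Y) : Set X := {x | (f x).Nonempty}

/-- Weihrauch reducibility: there are a computable forward functional `Φ` and a computable backward
functional `Ψ` such that for every name `p` of some `x ∈ dom f`, `Φ(p)` is a name of some
`z ∈ dom g`, and for every name `q` of an element of `g z`, `Ψ(⟨p, q⟩)` is a name of an element
of `f x`. -/
def WeihrauchLE {X Y Z W : Type*} [RepresentedSpace X] [RepresentedSpace Y] [RepresentedSpace Z]
    [RepresentedSpace W] (f : Problem X Y) (g : Problem Z W) : Prop :=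
  ∃ Φ Ψ : (ℕ → ℕ) →. (ℕ → ℕ), IsComputableFunctional Φ ∧ IsComputableFunctional Ψ ∧
    ∀ p x, IsName p x → x ∈ f.dom →
      ∃ p' ∈ Φ p, ∃ z, IsName p' z ∧ z ∈ g.dom ∧
        ∀ q w, IsName q w → w ∈ g z → ∃ r ∈ Ψ (joinSeq p q), ∃ y, IsName r y ∧ y ∈ f x

/-- Weihrauch equivalence. -/
def WeihrauchEquiv {X Y Z W : Type*} [RepresentedSpace X] [RepresentedSpace Y]
    [RepresentedSpace Z] [RepresentedSpace W] (f : Problem X Y) (g : Problem Z W) : Prop :=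
  WeihrauchLE f g ∧ WeihrauchLE g f

/-- The space `{0, 1}`: the name of a number `n` is the sequence `n, 0, 0, …`. -/
instance : RepresentedSpace (Fin 2) where
  IsName p n := p 0 = n ∧ ∀ m, 0 < m → p m = 0
  unique h h' := Fin.ext (h.1.symm.trans h'.1)
  surj n := ⟨fun m => if m = 0 then n else 0, by simp, fun m hm => by simp [hm.ne']⟩

/-! ### Trees and well-foundedness -/

/-- A tree in Baire space: a nonempty set of finite strings closed under initial segments. -/
abbrev BaireTree := {T : Descriptive.tree ℕ // ∃ σ, σ ∈ T}

/-- `T` is ill-founded if it has a path. -/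
def BaireTree.IllFounded (T : BaireTree) : Prop :=
  ∃ x : ℕ → ℕ, ∀ n, initSeg x n ∈ T.1

open Classical in
/-- The name of a tree is its characteristic function, finite strings being numbered by the
standard computable bijection `Encodable.encode : List ℕ → ℕ`. -/
noncomputable instance : RepresentedSpace BaireTree where
  IsName p T := ∀ σ : List ℕ, p (Encodable.encode σ) = if σ ∈ T.1 then 1 else 0
  unique {p T T'} h h' := by
    refine Subtype.ext (SetLike.ext fun σ => ?_)
    have := (h σ).symm.trans (h' σ)
    by_cases h1 : σ ∈ T.1 <;> by_cases h2 : σ ∈ T'.1 <;> simp_all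
  surj T := ⟨fun n => if Denumerable.ofNat (List ℕ) n ∈ T.1 then 1 else 0, fun σ => by simp⟩

open Classical in
/-- The problem `WF`: given a tree, answer `0` if it is well-founded and `1` otherwise. -/
noncomputable def WF : Problem BaireTree (Fin 2) :=
  fun T => {if T.IllFounded then 1 else 0}

/-! ### Countable ordered groups -/

/-- A countable ordered group, presented as a group on a set of natural numbers with a linear
order that is invariant under multiplication on both sides. The order is an arbitrary one,
unrelated to that of the natural numbers. -/
structure CountableOrderedGroup where
  carrier : Set ℕ
  group : Group carrier
  order : LinearOrder carrier
  mul_right_le : ∀ a b g, order.le a b → order.le (group.mul a g) (group.mul b g)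
  mul_left_le : ∀ a b g, order.le a b → order.le (group.mul g a) (group.mul g b)

namespace CountableOrderedGroup

/-- The type of elements of `G`. It is a type of its own, so that the order of `G` is not confused
with the one that subsets of `ℕ` inherit. -/
def Elem (G : CountableOrderedGroup) : Type := G.carrier

instance (G : CountableOrderedGroup) : Group G.Elem := G.group

instance (G : CountableOrderedGroup) : LinearOrder G.Elem := G.order

/-- The order type of `G` is `ℤ ^ X` (for `ε = 0`) or `ℤ ^ X · ℚ` (for `ε = 1`). Here `ℤ ^ X` is
the set of finitely supported functions from `X` to `ℤ`, compared at the largest argument where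
they differ, and in the product `ℤ ^ X · ℚ` the `ℚ`-coordinate is compared first. -/
def HasOrderType (G : CountableOrderedGroup) (X : Type) [LinearOrder X] (ε : Fin 2) : Prop :=
  match ε with
  | 0 => Nonempty (G.Elem ≃o Colex (X →₀ ℤ))
  | 1 => Nonempty (G.Elem ≃o ℚ ×ₗ Colex (X →₀ ℤ))

open Classical in
/-- `p` is a name of `G` if it lists the characteristic function of the set of elements, the
multiplication, and the characteristic function of the order relation. -/
def Codes (p : ℕ → ℕ) (G : CountableOrderedGroup) : Prop :=
  (∀ n, p (Nat.pair 0 n) = if n ∈ G.carrier then 1 else 0) ∧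
  (∀ a b : G.carrier, p (Nat.pair 1 (Nat.pair a b)) = G.group.mul a b) ∧
  ∀ a b : G.carrier, p (Nat.pair 2 (Nat.pair a b)) = if G.order.le a b then 1 else 0

theorem Codes.unique {p : ℕ → ℕ} {G H : CountableOrderedGroup} (hG : Codes p G)
    (hH : Codes p H) : G = H := by
  obtain ⟨S, gG, oG, h1, h2⟩ := G
  obtain ⟨S', gH, oH, h3, h4⟩ := H
  obtain ⟨c1, m1, l1⟩ := hG
  obtain ⟨c2, m2, l2⟩ := hH
  obtain rfl : S = S' := by
    ext n
    have := (c1 n).symm.trans (c2 n)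
    by_cases h1 : n ∈ S <;> by_cases h2 : n ∈ S' <;> simp_all
  obtain rfl : gG = gH := by
    refine Group.ext ?_
    ext a b
    exact (m1 a b).symm.trans (m2 a b)
  obtain rfl : oG = oH := by
    refine LinearOrder.toPartialOrder_injective (PartialOrder.toPreorder_injective
      (Preorder.toLE_injective (LE.ext ?_)))
    ext a b
    have := (l1 a b).symm.trans (l2 a b)
    by_cases h1 : oG.le a b <;> by_cases h2 : oH.le a b <;> simp_all
  rfl

open Classical in
theorem exists_codes (G : CountableOrderedGroup) : ∃ p, Codes p G := by
  refine ⟨fun n =>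
    if n.unpair.1 = 0 then (if n.unpair.2 ∈ G.carrier then 1 else 0)
    else if h : n.unpair.2.unpair.1 ∈ G.carrier ∧ n.unpair.2.unpair.2 ∈ G.carrier then
      if n.unpair.1 = 1 then (G.group.mul ⟨_, h.1⟩ ⟨_, h.2⟩ : G.carrier)
      else if G.order.le ⟨_, h.1⟩ ⟨_, h.2⟩ then 1 else 0
    else 0, ?_, ?_, ?_⟩
  · intro n; simp
  · intro a b; simp
  · intro a b; simp

instance : RepresentedSpace CountableOrderedGroup where
  IsName := Codes
  unique := Codes.unique
  surj := exists_codes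

end CountableOrderedGroup

/-- The problem `OG ↦ ε`: given a countable ordered group, output `ε ∈ {0, 1}` such that the order
type of the group is `ℤ ^ α · ℚ ^ ε` for some well-order `α`. -/
def OGToEps : Problem CountableOrderedGroup (Fin 2) :=
  fun G => {ε | ∃ (α : Type) (_ : LinearOrder α) (_ : WellFoundedLT α), G.HasOrderType α ε}

/-! The invariant behind `ε` is scatteredness. For a well-order `α` the order `ℤ ^ α` is scattered
(`Scattered.colex_finsupp`), while `ℤ ^ α · ℚ` contains a copy of `ℚ`. So `ε` can only be `0` for a
scattered group and `1` for any other.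

A value exists for the following reason. The elements `g` whose interval to `1` is scattered form a
convex subgroup `C`, and `G` is the lexicographic product of the cosets of `C` with `C`. Two
neighbouring cosets would merge into a larger scattered interval, so the cosets are densely ordered.
By Cantor's theorem they form one point or a copy of `ℚ`. In the scattered group `C`, each proper
convex subgroup `D` has an immediate successor coset `aD`. Then `a` normalizes `D`, the cosets `aⁿD`
fill the next convex subgroup, and the proper convex subgroups are well-ordered. Each element is a
unique finite product of powers of these `a`, in decreasing order of `D`. Such products compare at
the largest `D` where their exponents differ, which is the order of `ℤ ^ α`.

Both reductions use the Kleene–Brouwer order, which is dense on all strings and well-founded on a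
tree exactly when the tree has no path. From `G` one computes the tree of finite attempts to embed
this order into `G`; it has a path iff `G` is not scattered. From a tree `T` one computes the group
`ℤ ^ T`. It is scattered if `T` is well-founded. Otherwise the elements supported on a set of nodes
without least element are densely ordered. Least codes serve as group elements, so that each element
is represented by one number. -/

/-! ### Scattered sets -/

/-- A subset of a linear order is scattered if it has no densely ordered subset with more than one
element. -/
def Scattered {X : Type*} [LinearOrder X] (s : Set X) : Prop :=
  ∀ D ⊆ s, D.Nontrivial → ∃ x ∈ D, ∃ y ∈ D, x < y ∧ ∀ z ∈ D, x < z → ¬ z < y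

namespace Scattered

variable {X Y : Type*} [LinearOrder X] [LinearOrder Y]

theorem mono {s t : Set X} (h : Scattered t) (hst : s ⊆ t) : Scattered s :=
  fun D hD => h D (hD.trans hst)

theorem of_subsingleton {s : Set X} (h : s.Subsingleton) : Scattered s :=
  fun _ hD hn => absurd (h.anti hD) (Set.not_subsingleton_iff.2 hn)

theorem of_mapsTo {s : Set X} {t : Set Y} (h : Scattered t) (f : X → Y) (hf : StrictMono f)
    (hst : Set.MapsTo f s t) : Scattered s := by
  intro D hD hn
  obtain ⟨_, ⟨x, hx, rfl⟩, _, ⟨y, hy, rfl⟩, hxy, hz⟩ :=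
    h (f '' D) ((Set.image_mono hD).trans hst.image_subset) (hn.image hf.injective)
  exact ⟨x, hx, y, hy, hf.lt_iff_lt.1 hxy,
    fun z hzD h1 h2 => hz _ (Set.mem_image_of_mem f hzD) (hf h1) (hf h2)⟩

/-- A densely ordered subset with two elements of an order-convex scattered set `s` meets `s` in at
most one point. -/
theorem inter_subsingleton {s D : Set X} [hs : s.OrdConnected] (h : Scattered s)
    (hD : ∀ x ∈ D, ∀ y ∈ D, x < y → ∃ z ∈ D, x < z ∧ z < y) : (D ∩ s).Subsingleton := by
  by_contra hn
  rw [Set.not_subsingleton_iff] at hn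
  obtain ⟨x, hx, y, hy, hxy, hz⟩ := h _ Set.inter_subset_right hn
  obtain ⟨z, hzD, h1, h2⟩ := hD x hx.1 y hy.1 hxy
  exact hz z ⟨hzD, hs.out hx.2 hy.2 ⟨h1.le, h2.le⟩⟩ h1 h2

/-- A densely ordered `D` meets each of the two convex sets in at most one point, but two points of
`D` have a third between them: pigeonhole. -/
theorem union {s t : Set X} [hs : s.OrdConnected] [ht : t.OrdConnected] (h : Scattered s)
    (h' : Scattered t) : Scattered (s ∪ t) := by
  intro D hD hn
  by_contra! hc
  have h1 := h.inter_subsingleton hc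
  have h2 := h'.inter_subsingleton hc
  obtain ⟨x, hx, y, hy, hxy⟩ := hn.exists_lt
  obtain ⟨z, hz, hxz, hzy⟩ := hc x hx y hy hxy
  rcases hD hx with ax | ax <;> rcases hD hy with ay | ay <;> rcases hD hz with az | az
  all_goals first
    | exact hxy.ne (h1 ⟨hx, ax⟩ ⟨hy, ay⟩)
    | exact hxy.ne (h2 ⟨hx, ax⟩ ⟨hy, ay⟩)
    | exact hxz.ne (h1 ⟨hx, ax⟩ ⟨hz, az⟩)
    | exact hxz.ne (h2 ⟨hx, ax⟩ ⟨hz, az⟩)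
    | exact hzy.ne (h1 ⟨hz, az⟩ ⟨hy, ay⟩)
    | exact hzy.ne (h2 ⟨hz, az⟩ ⟨hy, ay⟩)

/-- A set is scattered as soon as all intervals with endpoints in it are. -/
theorem of_Icc {s : Set X} (h : ∀ x ∈ s, ∀ y ∈ s, x < y → Scattered (Set.Icc x y)) :
    Scattered s := by
  intro D hD hn
  by_contra! hc
  obtain ⟨x, hx, y, hy, hxy⟩ := hn.exists_lt
  exact hxy.ne ((h x (hD hx) y (hD hy) hxy).inter_subsingleton hc
    ⟨hx, Set.left_mem_Icc.2 hxy.le⟩ ⟨hy, Set.right_mem_Icc.2 hxy.le⟩)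

theorem subsingleton_of_denselyOrdered [DenselyOrdered X] (h : Scattered (Set.univ : Set X)) :
    Subsingleton X := by
  by_contra hX
  rw [not_subsingleton_iff_nontrivial] at hX
  obtain ⟨x, -, y, -, hxy, hz⟩ := h Set.univ subset_rfl Set.nontrivial_univ
  obtain ⟨z, h1, h2⟩ := exists_between hxy
  exact hz z trivial h1 h2

theorem _root_.Finsupp.colex_lt_iff {α N : Type*} [LinearOrder α] [Zero N] [LinearOrder N]
    {f g : Colex (α →₀ N)} :
    f < g ↔ ∃ a, (∀ b, a < b → ofColex f b = ofColex g b) ∧ ofColex f a < ofColex g a :=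
  Iff.rfl

/-- `ℤ ^ α` is scattered for a well-order `α`. -/
theorem colex_finsupp (α : Type*) [LinearOrder α] [WellFoundedLT α] :
    Scattered (Set.univ : Set (Colex (α →₀ ℤ))) := by
  intro D _ hn
  by_contra! hc
  let P : α → Prop := fun a => ∃ f ∈ D, ∃ g ∈ D,
    (∀ b, a < b → ofColex f b = ofColex g b) ∧ ofColex f a < ofColex g a
  have hP : ∃ a, P a := by
    obtain ⟨f, hf, g, hg, hfg⟩ := hn.exists_lt
    obtain ⟨a, ha⟩ := Finsupp.colex_lt_iff.1 hfg
    exact ⟨a, f, hf, g, hg, ha⟩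
  -- `a` is the least index that occurs as the last difference of two elements of `D`.
  obtain ⟨a, ⟨f, hf, g, hg, hab, hlt⟩, hmin⟩ := (wellFounded_lt (α := α)).has_min {a | P a} hP
  replace hmin : ∀ b, P b → a ≤ b := fun b hb => not_lt.1 (hmin b hb)
  -- between `f` and `g`, every element can be pushed up at the coordinate `a`, without end
  have key : ∀ n : ℕ, ∀ f ∈ D, (∀ b, a < b → ofColex f b = ofColex g b) →
      ofColex f a < ofColex g a → ofColex g a - ofColex f a ≤ n → False := by
    intro n
    induction n with
    | zero => intro f _ _ h1 h2; push_cast at h2; linarith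
    | succ n ih =>
      intro f hf hab hlt hn
      obtain ⟨h, hh, hfh, hhg⟩ := hc f hf g hg (Finsupp.colex_lt_iff.2 ⟨a, hab, hlt⟩)
      obtain ⟨b, hb, hb'⟩ := Finsupp.colex_lt_iff.1 hfh
      obtain ⟨c, hc, hc'⟩ := Finsupp.colex_lt_iff.1 hhg
      -- The last differences `b` of `f, h` and `c` of `h, g` are at least `a`. Neither can exceed
      -- `a`, because `f` and `g` agree above `a`. So both equal `a`, and the gap at `a` shrinks.
      have h1 := hmin b ⟨f, hf, h, hh, hb, hb'⟩
      have h2 := hmin c ⟨h, hh, g, hg, hc, hc'⟩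
      have hca : a = c := by
        by_contra hne
        have hac : a < c := lt_of_le_of_ne h2 hne
        rcases lt_trichotomy b c with hbc | hbc | hbc
        · have := hb c hbc
          have := hab c hac
          omega
        · subst hbc
          have := hab b hac
          omega
        · have := hab b (hac.trans hbc)
          have h3 := hc b hbc
          omega
      subst hca
      have hba : b = a := by
        by_contra hne
        have hac : a < b := lt_of_le_of_ne h1 (Ne.symm hne)
        have := hab b hac
        have h3 := hc b hac
        omega
      refine ih h hh hc hc' ?_
      rw [hba] at hb'
      push_cast at hn
      omega
  exact key (ofColex g a - ofColex f a).toNat f hf hab hlt (Int.self_le_toNat _)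

end Scattered

theorem not_scattered_lex_rat {X : Type*} [LinearOrder X] [Nonempty X] :
    ¬ Scattered (Set.univ : Set (ℚ ×ₗ X)) := by
  obtain ⟨x⟩ := ‹Nonempty X›
  intro h
  have := (h.of_mapsTo (s := Set.univ) (fun q : ℚ => toLex (q, x))
    (fun a b hab => (Prod.Lex.toLex_lt_toLex).2 (Or.inl hab))
    (Set.mapsTo_univ _ _)).subsingleton_of_denselyOrdered
  exact zero_ne_one (α := ℚ) (Subsingleton.elim _ _)

theorem scattered_univ_iff {X Y : Type*} [LinearOrder X] [LinearOrder Y] (e : X ≃o Y) :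
    Scattered (Set.univ : Set X) ↔ Scattered (Set.univ : Set Y) :=
  ⟨fun h => h.of_mapsTo e.symm e.symm.strictMono (Set.mapsTo_univ _ _),
    fun h => h.of_mapsTo e e.strictMono (Set.mapsTo_univ _ _)⟩

/-! ### Convex subgroups of ordered groups -/

set_option linter.unusedSectionVars false

namespace Subgroup

variable {G : Type*} [Group G] [LinearOrder G]

/-- A subgroup of an ordered group is convex if it contains every element between `1` and one of
its elements. -/
def IsConvex (D : Subgroup G) : Prop := ∀ ⦃g h⦄, h ∈ D → 1 ≤ g → g ≤ h → g ∈ D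

theorem isConvex_bot : (⊥ : Subgroup G).IsConvex := by
  intro g h hh h1 h2
  rw [mem_bot] at hh ⊢
  exact le_antisymm (hh ▸ h2) h1

theorem isConvex_sInf {S : Set (Subgroup G)} (h : ∀ D ∈ S, D.IsConvex) : (sInf S).IsConvex := by
  intro x y hy h1 h2
  rw [mem_sInf] at hy ⊢
  exact fun D hD => h D hD (hy D hD) h1 h2

variable [MulLeftMono G]

theorem exists_one_lt_of_not_le {D E : Subgroup G} (h : ¬ D ≤ E) : ∃ x ∈ D, 1 < x ∧ x ∉ E := by
  obtain ⟨x, hx, hxE⟩ := SetLike.not_le_iff_exists.1 h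
  have hx1 : x ≠ 1 := fun h => hxE (h ▸ E.one_mem)
  rcases lt_or_gt_of_ne hx1 with h1 | h1
  · exact ⟨x⁻¹, D.inv_mem hx, Left.one_lt_inv_iff.2 h1, fun h => hxE (inv_mem_iff.1 h)⟩
  · exact ⟨x, hx, h1, hxE⟩

/-- Compare positive witnesses of the two non-inclusions: the smaller one lies, by convexity, in the
subgroup that it was meant to avoid. -/
theorem IsConvex.total {D E : Subgroup G} (hD : D.IsConvex) (hE : E.IsConvex) :
    D ≤ E ∨ E ≤ D := by
  by_contra! h
  obtain ⟨x, hx, hx1, hxE⟩ := exists_one_lt_of_not_le h.1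
  obtain ⟨y, hy, hy1, hyD⟩ := exists_one_lt_of_not_le h.2
  rcases le_total x y with h1 | h1
  · exact hxE (hE hy hx1.le h1)
  · exact hyD (hD hx hy1.le h1)

theorem IsConvex.ordConnected {D : Subgroup G} (hD : D.IsConvex) : (D : Set G).OrdConnected := by
  refine ⟨fun x hx y hy z hz => ?_⟩
  have h : x⁻¹ * z ∈ D := hD (D.mul_mem (D.inv_mem hx) hy) (le_inv_mul_iff_le.2 hz.1)
    (mul_le_mul_right hz.2 _)
  simpa using D.mul_mem hx h

theorem scattered_uIcc_mul_left {x y : G} (g : G) (h : Scattered (Set.uIcc x y)) :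
    Scattered (Set.uIcc (g * x) (g * y)) := by
  refine h.of_mapsTo (g⁻¹ * ·) (fun _ _ hab => mul_lt_mul_right hab _) (fun z hz => ?_)
  rw [Set.mem_uIcc] at hz ⊢
  simpa [le_inv_mul_iff_mul_le, inv_mul_le_iff_le_mul] using hz

theorem _root_.Scattered.uIcc_trans {X : Type*} [LinearOrder X] {x y z : X}
    (h : Scattered (Set.uIcc x y))
    (h' : Scattered (Set.uIcc y z)) : Scattered (Set.uIcc x z) :=
  (h.union h').mono Set.uIcc_subset_uIcc_union_uIcc

variable [MulRightMono G] {D : Subgroup G}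

/-- Otherwise `1 ≤ x⁻¹y ≤ cd⁻¹`, and convexity puts `x⁻¹y` into `D`. Thus the order between distinct
cosets does not depend on representatives. -/
theorem IsConvex.mul_lt_mul (hD : D.IsConvex) {x y c d : G} (hxy : x < y) (h : x⁻¹ * y ∉ D)
    (hc : c ∈ D) (hd : d ∈ D) : x * c < y * d := by
  by_contra! hn
  refine h (hD (D.mul_mem hc (D.inv_mem hd)) ?_ ?_)
  · exact (le_inv_mul_iff_le.2 hxy.le)
  · rw [le_mul_inv_iff_mul_le, mul_assoc]
    exact inv_mul_le_iff_le_mul.2 hn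

/-! ### Cosets of convex subgroups -/

/-- The order on the left cosets given by representatives. -/
@[reducible] noncomputable def cosetOrder (D : Subgroup G) : LinearOrder (G ⧸ D) :=
  LinearOrder.lift' Quotient.out Quotient.out_injective

attribute [local instance] cosetOrder

theorem out_strictMono : StrictMono (fun q : G ⧸ D => q.out) := fun _ _ h => h

theorem IsConvex.mk_lt_mk (hD : D.IsConvex) {x y : G} (hxy : x < y) (h : x⁻¹ * y ∉ D) :
    (x : G ⧸ D) < (y : G ⧸ D) := by
  obtain ⟨c, hc⟩ := QuotientGroup.mk_out_eq_mul D x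
  obtain ⟨d, hd⟩ := QuotientGroup.mk_out_eq_mul D y
  change Quotient.out (x : G ⧸ D) < Quotient.out (y : G ⧸ D)
  rw [hc, hd]
  exact hD.mul_lt_mul hxy h c.2 d.2

/-- The convex subgroup `D` has no successor among its cosets. -/
def IsDenseIn (D : Subgroup G) : Prop :=
  ∀ a, 1 < a → a ∉ D → ∃ g, 1 < g ∧ g < a ∧ g ∉ D ∧ a⁻¹ * g ∉ D

/-- Left translation moves a pair of cosets to `D` and `aD`, so it is enough that no coset is the
immediate successor of `D` itself. -/
theorem IsConvex.denselyOrdered (hD : D.IsConvex) (h : D.IsDenseIn) : DenselyOrdered (G ⧸ D) := by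
  refine ⟨fun q r hqr => ?_⟩
  have hlt : q.out < r.out := hqr
  obtain ⟨g, h1, h2, h3, h4⟩ := h (q.out⁻¹ * r.out) (lt_inv_mul_iff_lt.2 hlt) (fun hm => by
    refine hqr.ne ?_
    rw [← QuotientGroup.out_eq' q, ← QuotientGroup.out_eq' r]
    exact QuotientGroup.eq.2 hm)
  refine ⟨((q.out * g : G) : G ⧸ D), ?_, ?_⟩
  · conv_lhs => rw [← QuotientGroup.out_eq' q]
    exact hD.mk_lt_mk (lt_mul_of_one_lt_right' _ h1) (by simpa using h3)
  · conv_rhs => rw [← QuotientGroup.out_eq' r]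
    refine hD.mk_lt_mk (lt_inv_mul_iff_mul_lt.1 h2) (fun hm => h4 ?_)
    rw [← inv_mem_iff]
    convert hm using 1
    group

theorem IsConvex.noMaxOrder (hD : D.IsConvex) (h : D ≠ ⊤) : NoMaxOrder (G ⧸ D) := by
  obtain ⟨x, -, h1, hx⟩ := exists_one_lt_of_not_le (fun hle => h (top_le_iff.1 hle))
  refine ⟨fun q => ⟨((q.out * x : G) : G ⧸ D), ?_⟩⟩
  conv_lhs => rw [← QuotientGroup.out_eq' q]
  exact hD.mk_lt_mk (lt_mul_of_one_lt_right' _ h1) (by simpa using hx)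

theorem IsConvex.noMinOrder (hD : D.IsConvex) (h : D ≠ ⊤) : NoMinOrder (G ⧸ D) := by
  obtain ⟨x, -, h1, hx⟩ := exists_one_lt_of_not_le (fun hle => h (top_le_iff.1 hle))
  refine ⟨fun q => ⟨((q.out * x⁻¹ : G) : G ⧸ D), ?_⟩⟩
  conv_rhs => rw [← QuotientGroup.out_eq' q]
  exact hD.mk_lt_mk (mul_lt_of_lt_one_right' _ (Left.inv_lt_one_iff.2 h1)) (by simpa using hx)

/-- An ordered group is the lexicographic product of the cosets of a convex subgroup and that
subgroup. -/
theorem IsConvex.exists_orderIso (hD : D.IsConvex) : Nonempty (G ≃o (G ⧸ D) ×ₗ D) := by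
  have hm : ∀ g : G, (g : G ⧸ D).out⁻¹ * g ∈ D := fun g =>
    QuotientGroup.eq.1 (QuotientGroup.out_eq' _)
  refine ⟨StrictMono.orderIsoOfSurjective
    (fun g : G => (toLex ((g : G ⧸ D), ⟨_, hm g⟩) : (G ⧸ D) ×ₗ D)) ?_ ?_⟩
  · intro x y hxy
    rw [Prod.Lex.toLex_lt_toLex]
    by_cases h : x⁻¹ * y ∈ D
    · have he : (x : G ⧸ D) = y := QuotientGroup.eq.2 h
      refine Or.inr ⟨he, ?_⟩
      change (x : G ⧸ D).out⁻¹ * x < (y : G ⧸ D).out⁻¹ * y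
      rw [he]
      exact mul_lt_mul_right hxy _
    · exact Or.inl (hD.mk_lt_mk hxy h)
  · intro p
    obtain ⟨⟨q, c⟩, rfl⟩ := toLex.surjective p
    have hq : ((q.out * c : G) : G ⧸ D) = q := by
      conv_rhs => rw [← QuotientGroup.out_eq' q]
      exact QuotientGroup.eq.2 (by simp)
    refine ⟨q.out * c, ?_⟩
    change toLex _ = toLex _
    congr 1
    refine Prod.ext hq (Subtype.ext ?_)
    change ((q.out * c : G) : G ⧸ D).out⁻¹ * (q.out * c) = c
    rw [hq]
    simp

/-! ### The scattered radical -/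

variable (G) in
/-- The largest convex subgroup that is scattered. -/
def scatteredRadical : Subgroup G where
  carrier := {g | Scattered (Set.uIcc 1 g)}
  one_mem' := Scattered.of_subsingleton (by simp)
  -- The interval from `1` to `gh` is covered by the one from `1` to `g` and the `g`-translate of
  -- the one from `1` to `h`.
  mul_mem' {g h} hg hh := Scattered.uIcc_trans hg (by
    simpa using scattered_uIcc_mul_left g hh)
  inv_mem' {g} hg := by
    have := scattered_uIcc_mul_left g⁻¹ hg
    rw [Set.uIcc_comm] at this
    simpa using this

theorem scatteredRadical_isConvex : (scatteredRadical G).IsConvex := by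
  intro g h hh h1 h2
  refine Scattered.mono hh (Set.uIcc_subset_uIcc Set.left_mem_uIcc ?_)
  exact Set.mem_uIcc.2 (Or.inl ⟨h1, h2⟩)

theorem scatteredRadical_scattered : Scattered (scatteredRadical G : Set G) := by
  refine Scattered.of_Icc fun x hx y hy hxy => ?_
  have := scattered_uIcc_mul_left x
    ((scatteredRadical G).mul_mem ((scatteredRadical G).inv_mem hx) hy)
  rw [← Set.uIcc_of_le hxy.le]
  simpa using this

/-- If no coset lay strictly between `C` and `aC`, the interval `[1, a]` would be contained in `C ∪
aC`. This is a union of two convex scattered sets, so `a` would belong to `C`. -/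
theorem scatteredRadical_isDenseIn : (scatteredRadical G).IsDenseIn := by
  intro a ha haC
  by_contra! h
  refine haC ?_
  let C := scatteredRadical G
  let f : G → G := fun x => a⁻¹ * x
  have hf : StrictMono f := fun _ _ hab => mul_lt_mul_right hab _
  have hC : Scattered (C : Set G) := scatteredRadical_scattered
  have hCo : (C : Set G).OrdConnected := scatteredRadical_isConvex.ordConnected
  have hCo' : (f ⁻¹' (C : Set G)).OrdConnected := hCo.preimage_mono hf.monotone
  refine (hC.union (hC.of_mapsTo f hf (Set.mapsTo_preimage f C))).mono fun g hg => ?_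
  rw [Set.uIcc_of_le ha.le] at hg
  rcases hg.1.eq_or_lt with rfl | h1
  · exact Or.inl C.one_mem
  rcases hg.2.eq_or_lt with rfl | h2
  · refine Or.inr ?_
    simp [f, C.one_mem]
  by_cases hgC : g ∈ C
  · exact Or.inl hgC
  · exact Or.inr (h g h1 h2 hgC)

theorem cosets_orderIso_rat [Countable G] (h : scatteredRadical G ≠ ⊤) :
    Nonempty ((G ⧸ scatteredRadical G) ≃o ℚ) := by
  have := scatteredRadical_isConvex.noMaxOrder h
  have := scatteredRadical_isConvex.noMinOrder h
  have := scatteredRadical_isConvex.denselyOrdered (scatteredRadical_isDenseIn (G := G))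
  have : Countable (G ⧸ scatteredRadical G) := Quotient.countable
  exact Order.iso_of_countable_dense _ _

/-- Representatives of the cosets form a densely ordered subset of the scattered group, so there is
only one coset. -/
theorem eq_top_of_isDenseIn (hG : Scattered (Set.univ : Set G)) (hD : D.IsConvex)
    (h : D.IsDenseIn) : D = ⊤ := by
  have := hD.denselyOrdered h
  have : Subsingleton (G ⧸ D) := (hG.of_mapsTo (fun q : G ⧸ D => q.out) out_strictMono
    (Set.mapsTo_univ _ _)).subsingleton_of_denselyOrdered
  rw [eq_top_iff]
  intro x _
  have := QuotientGroup.eq.1 (Subsingleton.elim ((1 : G) : G ⧸ D) x)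
  simpa using this

end Subgroup

/-! ### The order type of a scattered ordered group -/

namespace Subgroup

variable {G : Type*} [Group G] [LinearOrder G] [MulLeftMono G] [MulRightMono G] {D : Subgroup G}

/-- The coset `a D` is the immediate successor of `D`. -/
structure IsSucc (D : Subgroup G) (a : G) : Prop where
  one_lt : 1 < a
  notMem : a ∉ D
  between : ∀ g, 1 < g → g < a → g ∉ D → a⁻¹ * g ∈ D

theorem exists_isSucc (hG : Scattered (Set.univ : Set G)) (hD : D.IsConvex) (h : D ≠ ⊤) :
    ∃ a, D.IsSucc a := by
  by_contra! hn
  refine h (eq_top_of_isDenseIn hG hD fun a h1 h2 => ?_)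
  by_contra! hg
  exact hn a ⟨h1, h2, hg⟩

/-! ### From a convex subgroup to the next one -/

namespace IsSucc

variable {a : G}

theorem lt_of_mem (ha : D.IsSucc a) (hD : D.IsConvex) {c : G} (hc : c ∈ D) : c < a := by
  by_contra! h
  exact ha.notMem (hD hc ha.one_lt.le h)

/-- Any larger convex subgroup contains `a`. -/
theorem mem_of_not_le (ha : D.IsSucc a) {E : Subgroup G} (hE : E.IsConvex) (hDE : D ≤ E)
    (h : ¬ E ≤ D) : a ∈ E := by
  obtain ⟨x, hx, hx1, hxD⟩ := exists_one_lt_of_not_le h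
  rcases le_or_gt a x with h1 | h1
  · exact hE hx ha.one_lt.le h1
  -- Here `x ∈ aD`, and `a = x (a⁻¹x)⁻¹`.
  · have := E.mul_mem hx (E.inv_mem (hDE (ha.between x hx1 h1 hxD)))
    simpa using this

/-- For `c > 1` in `D`, `c < a` gives `1 < aca⁻¹ < a`. If `aca⁻¹` were outside `D`, it would lie in
`aD`; then `ca⁻¹ ∈ D`, and hence `a ∈ D`. -/
theorem conj_mem (ha : D.IsSucc a) (hD : D.IsConvex) {c : G} (hc : c ∈ D) :
    a * c * a⁻¹ ∈ D := by
  have key : ∀ c ∈ D, 1 ≤ c → a * c * a⁻¹ ∈ D := by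
    intro c hc h1
    rcases h1.eq_or_lt with rfl | h1
    · simp
    by_contra hn
    have h2 : 1 < a * c * a⁻¹ := by
      rw [lt_mul_inv_iff_mul_lt, one_mul]
      exact lt_mul_of_one_lt_right' _ h1
    have h3 : a * c * a⁻¹ < a := by
      rw [mul_assoc]
      refine mul_lt_of_lt_one_right' _ ?_
      rw [mul_inv_lt_iff_lt_mul, one_mul]
      exact ha.lt_of_mem hD hc
    have h4 := D.mul_mem (D.inv_mem hc) (ha.between _ h2 h3 hn)
    refine ha.notMem (inv_mem_iff.1 ?_)
    convert h4 using 1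
    group
  rcases le_total 1 c with h1 | h1
  · exact key c hc h1
  · have := D.inv_mem (key c⁻¹ (D.inv_mem hc) (Left.one_le_inv_iff.2 h1))
    convert this using 1
    group

/-- For `c < 1` in `D`, the element `ca` lies strictly between `1` and `a` and outside `D`, hence in
`aD`. Together with `conj_mem`, this shows that `a` normalizes `D`. -/
theorem conj_mem' (ha : D.IsSucc a) (hD : D.IsConvex) {c : G} (hc : c ∈ D) :
    a⁻¹ * c * a ∈ D := by
  have key : ∀ c ∈ D, c ≤ 1 → a⁻¹ * c * a ∈ D := by
    intro c hc h1
    rcases h1.eq_or_lt with rfl | h1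
    · simp
    rw [mul_assoc]
    refine ha.between _ ?_ (mul_lt_of_lt_one_left' _ h1) fun h => ha.notMem ?_
    · rw [← inv_mul_lt_iff_lt_mul, mul_one]
      exact ha.lt_of_mem hD (D.inv_mem hc)
    · simpa using D.mul_mem (D.inv_mem hc) h
  rcases le_total c 1 with h1 | h1
  · exact key c hc h1
  · have := D.inv_mem (key c⁻¹ (D.inv_mem hc) (Left.inv_le_one_iff.2 h1))
    convert this using 1
    group

theorem conj_zpow_mem (ha : D.IsSucc a) (hD : D.IsConvex) (n : ℤ) {c : G} (hc : c ∈ D) :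
    a ^ n * c * (a ^ n)⁻¹ ∈ D := by
  have h : a ∈ normalizer (D : Set G) := by
    rw [mem_normalizer_iff]
    refine fun c => ⟨ha.conj_mem hD, fun h => ?_⟩
    convert ha.conj_mem' hD h using 1
    group
  exact (mem_normalizer_iff.1 ((normalizer (D : Set G)).zpow_mem h n) c).1 hc

theorem notMem_zpow (ha : D.IsSucc a) (hD : D.IsConvex) {n : ℤ} (hn : 0 < n) : a ^ n ∉ D := by
  refine fun h => ha.notMem (hD h ha.one_lt.le ?_)
  conv_lhs => rw [← zpow_one a]
  obtain ⟨k, rfl⟩ : ∃ k : ℕ, n = 1 + k := ⟨(n - 1).toNat, by omega⟩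
  rw [zpow_add, zpow_one, zpow_natCast]
  exact le_mul_of_one_le_right' (one_le_pow_of_one_le' ha.one_lt.le k)

theorem zpow_mul_lt (ha : D.IsSucc a) (hD : D.IsConvex) {m n : ℤ} (hmn : m < n) {c d : G}
    (hc : c ∈ D) (hd : d ∈ D) : a ^ m * c < a ^ n * d := by
  have h : (a ^ m)⁻¹ * a ^ n = a ^ (n - m) := by group
  refine hD.mul_lt_mul ?_ ?_ hc hd
  · rw [← lt_inv_mul_iff_lt, h]
    obtain ⟨k, hk⟩ : ∃ k : ℕ, n - m = k := ⟨(n - m).toNat, by omega⟩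
    rw [hk, zpow_natCast]
    exact one_lt_pow' ha.one_lt (by omega)
  · rw [h]
    exact ha.notMem_zpow hD (by omega)

/-- The next convex subgroup above `D`. -/
def next (ha : D.IsSucc a) (hD : D.IsConvex) : Subgroup G where
  carrier := {h | ∃ n : ℤ, (a ^ n)⁻¹ * h ∈ D}
  one_mem' := ⟨0, by simp⟩
  mul_mem' := by
    rintro g h ⟨m, hm⟩ ⟨n, hn⟩
    refine ⟨m + n, ?_⟩
    -- `a⁻⁽ᵐ⁺ⁿ⁾gh = (a⁻ⁿ(a⁻ᵐg)aⁿ)(a⁻ⁿh)`.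
    convert D.mul_mem (ha.conj_zpow_mem hD (-n) hm) hn using 1
    group
  inv_mem' := by
    rintro g ⟨m, hm⟩
    refine ⟨-m, ?_⟩
    convert ha.conj_zpow_mem hD m (D.inv_mem hm) using 1
    group

/-- The interval `[1, a)` is covered by `D` and `aD`. Translating by powers of `a` covers each `[1,
aᴺ)` by cosets `aⁿD`, and every element of `aⁿD` is below `aⁿ⁺¹`. -/
theorem next_isConvex (ha : D.IsSucc a) (hD : D.IsConvex) : (ha.next hD).IsConvex := by
  have key : ∀ N : ℕ, ∀ g, 1 ≤ g → g < a ^ N → g ∈ ha.next hD := by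
    intro N
    induction N with
    | zero => intro g h1 h2; exact absurd h2 (by simpa using h1)
    | succ N ih =>
      intro g h1 h2
      rcases lt_or_ge g (a ^ N) with h3 | h3
      · exact ih g h1 h3
      have h4 : 1 ≤ (a ^ N)⁻¹ * g := le_inv_mul_iff_le.2 h3
      have h5 : (a ^ N)⁻¹ * g < a := by
        rw [inv_mul_lt_iff_lt_mul, ← pow_succ]
        exact h2
      by_cases h6 : (a ^ N)⁻¹ * g ∈ D
      · exact ⟨N, by simpa using h6⟩
      · rcases h4.eq_or_lt with h4 | h4
        · exact absurd (h4 ▸ D.one_mem) h6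
        · refine ⟨N + 1, ?_⟩
          convert ha.between _ h4 h5 h6 using 1
          rw [zpow_add, zpow_one, zpow_natCast]
          group
  rintro g h ⟨n, hn⟩ h1 h2
  refine key (n + 1).toNat g h1 (h2.trans_lt ?_)
  have h3 : h < a ^ (n + 1) := by
    have := ha.zpow_mul_lt hD (lt_add_one n) hn D.one_mem
    simpa using this
  rcases le_or_gt 0 (n + 1) with h4 | h4
  · rw [← zpow_natCast, Int.toNat_of_nonneg h4]
    exact h3
  · have := ha.zpow_mul_lt hD h4 D.one_mem D.one_mem
    simp only [mul_one, zpow_zero] at this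
    exact absurd (h1.trans h2) (h3.trans this).not_ge

theorem mem_next (ha : D.IsSucc a) (hD : D.IsConvex) : a ∈ ha.next hD := ⟨1, by simp⟩

end IsSucc

/-- The proper convex subgroups. -/
abbrev ProperConvex (G : Type*) [Group G] [LinearOrder G] :=
  {D : Subgroup G // D.IsConvex ∧ D ≠ ⊤}

/-! ### Expansion of elements along the chain of convex subgroups -/

namespace ProperConvex

open Classical in
noncomputable instance : LinearOrder (ProperConvex G) where
  le_total D E := D.2.1.total E.2.1
  toDecidableLE := Classical.decRel _

/-- In a scattered ordered group, the proper convex subgroups are well-ordered by inclusion. -/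
theorem wellFoundedLT (hG : Scattered (Set.univ : Set G)) : WellFoundedLT (ProperConvex G) := by
  refine ⟨WellFounded.wellFounded_iff_has_min.2 fun S ⟨F, hF⟩ => ?_⟩
  have hI : (sInf (Subtype.val '' S) : Subgroup G).IsConvex := isConvex_sInf (by
    rintro _ ⟨E, -, rfl⟩
    exact E.2.1)
  have hle : ∀ E ∈ S, sInf (Subtype.val '' S) ≤ E.1 := fun E hE => sInf_le ⟨E, hE, rfl⟩
  -- If `S` has no least member, each member lies strictly above the intersection and so contains
  -- `a`; but then `a` is in the intersection.
  obtain ⟨a, ha⟩ := exists_isSucc hG hI fun h => F.2.2 (top_le_iff.1 (h.ge.trans (hle F hF)))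
  by_contra! hn
  refine ha.notMem (mem_sInf.2 ?_)
  rintro _ ⟨E, hE, rfl⟩
  refine ha.mem_of_not_le E.2.1 (hle E hE) fun h => ?_
  obtain ⟨E', hE', hlt⟩ := hn E hE
  exact hlt.not_ge (h.trans (hle E' hE'))

variable {a : ProperConvex G → G}

/-- Every `g ≠ 1` has a leading term. -/
theorem exists_leading (ha : ∀ D : ProperConvex G, D.1.IsSucc (a D)) {g : G} (hg : g ≠ 1) :
    ∃ D : ProperConvex G, g ∉ D.1 ∧ ∃ n : ℤ, (a D ^ n)⁻¹ * g ∈ D.1 := by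
  -- The union `M` of this chain is the largest convex subgroup without `g`. The next convex
  -- subgroup above `M` must therefore contain `g`.
  let S : Set (Subgroup G) := {D | D.IsConvex ∧ g ∉ D}
  have hmem : ∀ {x}, x ∈ sSup S ↔ ∃ D ∈ S, x ∈ D := by
    intro x
    have hbot : (⊥ : Subgroup G) ∈ S := ⟨isConvex_bot, by simpa using hg⟩
    refine mem_sSup_of_directedOn ⟨⊥, hbot⟩ ?_
    intro D hD E hE
    rcases hD.1.total hE.1 with h | h
    · exact ⟨E, hE, h, le_rfl⟩
    · exact ⟨D, hD, le_rfl, h⟩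
  have hgS : g ∉ sSup S := by
    rw [hmem]
    rintro ⟨D, hD, hgD⟩
    exact hD.2 hgD
  have hconv : (sSup S).IsConvex := by
    intro x y hy h1 h2
    obtain ⟨D, hD, hyD⟩ := hmem.1 hy
    exact hmem.2 ⟨D, hD, hD.1 hyD h1 h2⟩
  let M : ProperConvex G := ⟨sSup S, hconv, fun h => hgS (h ▸ mem_top g)⟩
  refine ⟨M, hgS, ?_⟩
  by_contra hn
  have : (ha M).next M.2.1 ≤ sSup S := le_sSup ⟨(ha M).next_isConvex M.2.1, hn⟩
  exact (ha M).notMem (this ((ha M).mem_next M.2.1))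

/-- The product of the powers of the `a D`, in decreasing order of `D`. -/
noncomputable def expand (a : ProperConvex G → G) (f : ProperConvex G →₀ ℤ) : G :=
  ((f.support.sort (· ≥ ·)).map fun D => a D ^ f D).prod

theorem expand_zero : expand a 0 = 1 := by simp [expand]

theorem expand_single_add {f : ProperConvex G →₀ ℤ} {D : ProperConvex G}
    (hf : ∀ E ∈ f.support, E < D) (n : ℤ) :
    expand a (Finsupp.single D n + f) = a D ^ n * expand a f := by
  rcases eq_or_ne n 0 with rfl | hn
  · simp
  have hD : D ∉ f.support := fun h => (hf D h).false
  rw [expand, Finsupp.support_single_add hD hn, Finset.sort_cons _ (fun E hE => (hf E hE).le),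
    List.map_cons, List.prod_cons]
  congr 1
  · simp [Finsupp.notMem_support_iff.1 hD]
  · rw [expand]
    congr 1
    refine List.map_congr_left fun E hE => ?_
    rw [Finset.mem_sort] at hE
    simp [(hf E hE).ne]

theorem expand_mem (ha : ∀ D : ProperConvex G, D.1.IsSucc (a D))
    {f : ProperConvex G →₀ ℤ} {D : ProperConvex G}
    (hf : ∀ E ∈ f.support, E < D) : expand a f ∈ D.1 := by
  refine list_prod_mem fun x hx => ?_
  obtain ⟨E, hE, rfl⟩ := List.mem_map.1 hx
  have hlt := hf E ((Finset.mem_sort _).1 hE)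
  exact D.1.zpow_mem ((ha E).mem_of_not_le D.2.1 hlt.le hlt.not_ge) _

/-- Look at the largest `D` in either support. The remaining factors lie in `D`, so different
exponents at `D` decide by `zpow_mul_lt`; equal ones cancel, leaving a smaller union of supports. -/
theorem expand_strictMono (ha : ∀ D : ProperConvex G, D.1.IsSucc (a D)) :
    ∀ f g : Colex (ProperConvex G →₀ ℤ), f < g →
      expand a (ofColex f) < expand a (ofColex g) := by
  classical
  suffices h : ∀ n, ∀ f g : ProperConvex G →₀ ℤ, (f.support ∪ g.support).card = n →
      toColex f < toColex g → expand a f < expand a g from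
    fun f g hfg => h _ (ofColex f) (ofColex g) rfl hfg
  intro n
  induction n using Nat.strong_induction_on with
  | _ n ih =>
  intro f g hn hfg
  have hne : (f.support ∪ g.support).Nonempty := by
    rw [Finset.nonempty_iff_ne_empty]
    intro h
    rw [Finset.union_eq_empty, Finsupp.support_eq_empty, Finsupp.support_eq_empty] at h
    rw [h.1, h.2] at hfg
    exact hfg.false
  obtain ⟨D, hD, hmax⟩ := Finset.exists_max_image _ id hne
  have hlt : ∀ h : ProperConvex G →₀ ℤ, h.support ⊆ f.support ∪ g.support →
      ∀ E ∈ (h.erase D).support, E < D := by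
    intro h hh E hE
    rw [Finsupp.support_erase, Finset.mem_erase] at hE
    exact lt_of_le_of_ne (hmax E (hh hE.2)) hE.1
  have hf := hlt f Finset.subset_union_left
  have hg := hlt g Finset.subset_union_right
  have hf' : expand a f = a D ^ f D * expand a (f.erase D) := by
    rw [← expand_single_add hf, Finsupp.single_add_erase]
  have hg' : expand a g = a D ^ g D * expand a (g.erase D) := by
    rw [← expand_single_add hg, Finsupp.single_add_erase]
  obtain ⟨E, hE, hlt'⟩ := Finsupp.colex_lt_iff.1 hfg
  change f E < g E at hlt'
  replace hE : ∀ b, E < b → f b = g b := hE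
  rw [hf', hg']
  rcases lt_trichotomy (f D) (g D) with h | h | h
  · exact (ha D).zpow_mul_lt D.2.1 h (expand_mem ha hf) (expand_mem ha hg)
  · rw [h]
    refine mul_lt_mul_right (ih _ ?_ _ _ rfl ?_) _
    · rw [← hn, Finsupp.support_erase, Finsupp.support_erase, ← Finset.erase_union_distrib]
      exact Finset.card_erase_lt_of_mem hD
    · refine Finsupp.colex_lt_iff.2 ⟨E, fun b hb => ?_, ?_⟩
      · change f.erase D b = g.erase D b
        rcases eq_or_ne b D with rfl | hbD
        · simp
        · rw [Finsupp.erase_ne hbD, Finsupp.erase_ne hbD, hE b hb]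
      · change f.erase D E < g.erase D E
        have hED : E ≠ D := fun h' => by subst h'; omega
        rwa [Finsupp.erase_ne hED, Finsupp.erase_ne hED]
  · exfalso
    rcases lt_trichotomy E D with h' | rfl | h'
    · exact h.ne' (hE D h')
    · omega
    · have hE' : E ∉ f.support ∪ g.support := fun hE' => (hmax E hE').not_gt h'
      simp only [Finset.mem_union, Finsupp.mem_support_iff, not_or, not_not] at hE'
      omega

theorem expand_surjective (hG : Scattered (Set.univ : Set G))
    (ha : ∀ D : ProperConvex G, D.1.IsSucc (a D))
    (g : G) : ∃ f, expand a f = g := by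
  have := wellFoundedLT hG
  -- The bound on the support lets the leading power be prepended by `expand_single_add`.
  have key : ∀ D : ProperConvex G, ∀ g ∈ D.1, ∃ f : ProperConvex G →₀ ℤ,
      (∀ E ∈ f.support, E < D) ∧ expand a f = g := by
    intro D
    induction D using WellFoundedLT.induction with
    | _ D ih =>
    intro g hg
    rcases eq_or_ne g 1 with rfl | h1
    · exact ⟨0, by simp, expand_zero⟩
    obtain ⟨M, hM, n, hn⟩ := exists_leading ha h1
    have hMD : M < D := lt_of_not_ge fun h => hM (h hg)
    obtain ⟨f, hf, hfg⟩ := ih M hMD _ hn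
    refine ⟨Finsupp.single M n + f, fun E hE => ?_, ?_⟩
    · classical
      rcases Finset.mem_union.1 (Finsupp.support_add hE) with h | h
      · rw [Finset.mem_singleton.1 (Finsupp.support_single_subset h)]
        exact hMD
      · exact (hf E h).trans hMD
    · rw [expand_single_add hf, hfg, mul_inv_cancel_left]
  -- The whole group is not a proper subgroup, so the first leading term is split off outside the
  -- induction.
  rcases eq_or_ne g 1 with rfl | h1
  · exact ⟨0, expand_zero⟩
  obtain ⟨M, hM, n, hn⟩ := exists_leading ha h1
  obtain ⟨f, hf, hfg⟩ := key M _ hn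
  exact ⟨Finsupp.single M n + f, by rw [expand_single_add hf, hfg, mul_inv_cancel_left]⟩

/-- A scattered ordered group has order type `ℤ ^ α` for a well-order `α`. -/
theorem exists_orderIso (hG : Scattered (Set.univ : Set G)) :
    Nonempty (G ≃o Colex (ProperConvex G →₀ ℤ)) := by
  choose a ha using fun D : ProperConvex G => exists_isSucc hG D.2.1 D.2.2
  exact ⟨(StrictMono.orderIsoOfSurjective (fun f => expand a (ofColex f))
    (fun f g => expand_strictMono ha f g)
    (fun g => (expand_surjective hG ha g).imp fun f hf => hf)).symm⟩

end ProperConvex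

end Subgroup

/-! ### Order types of countable ordered groups -/

namespace CountableOrderedGroup

variable (G : CountableOrderedGroup)

instance : MulLeftMono G.Elem := ⟨fun g a b h => G.mul_left_le a b g h⟩

instance : MulRightMono G.Elem := ⟨fun g a b h => G.mul_right_le a b g h⟩

instance : Countable G.Elem := inferInstanceAs (Countable G.carrier)

variable {G} in
/-- An ordered group has an order type with `ε = 0` only if it is scattered, and with `ε = 1` only
if it is not. -/
theorem HasOrderType.eq_ite {X : Type} [LinearOrder X] [WellFoundedLT X] {ε : Fin 2}
    (h : G.HasOrderType X ε) : ε = 0 ↔ Scattered (Set.univ : Set G.Elem) := by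
  match ε, h with
  | 0, ⟨e⟩ => simpa using (scattered_univ_iff e).2 (Scattered.colex_finsupp X)
  | 1, ⟨e⟩ =>
    simp only [Fin.isValue, one_ne_zero, false_iff]
    exact fun h => not_scattered_lex_rat ((scattered_univ_iff e).1 h)

/-- The scattered radical `C` contributes `ℤ ^ α`; its cosets contribute nothing if `C` is
everything, and `ℚ` otherwise. -/
theorem exists_hasOrderType : ∃ (ε : Fin 2) (α : Type) (_ : LinearOrder α) (_ : WellFoundedLT α),
    G.HasOrderType α ε := by
  let C := Subgroup.scatteredRadical G.Elem
  have : MulLeftMono C := ⟨fun g a b h => mul_le_mul_right (α := G.Elem) h g⟩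
  have : MulRightMono C := ⟨fun g a b h => mul_le_mul_left (α := G.Elem) h g⟩
  have hC : Scattered (Set.univ : Set C) :=
    (Subgroup.scatteredRadical_scattered (G := G.Elem)).of_mapsTo Subtype.val
      (Subtype.strictMono_coe _) (fun x _ => x.2)
  have hwf := Subgroup.ProperConvex.wellFoundedLT hC
  obtain ⟨e⟩ := Subgroup.ProperConvex.exists_orderIso hC
  by_cases h : C = ⊤
  · refine ⟨0, Subgroup.ProperConvex C, inferInstance, hwf, ⟨OrderIso.trans ?_ e⟩⟩
    exact StrictMono.orderIsoOfSurjective (fun g : G.Elem => (⟨g, h ▸ Subgroup.mem_top g⟩ : C))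
      (fun _ _ h => h) (fun c => ⟨c.1, rfl⟩)
  · let _ := Subgroup.cosetOrder C
    obtain ⟨e₁⟩ := (Subgroup.scatteredRadical_isConvex (G := G.Elem)).exists_orderIso
    obtain ⟨e₂⟩ := Subgroup.cosets_orderIso_rat h
    exact ⟨1, Subgroup.ProperConvex C, inferInstance, hwf,
      ⟨e₁.trans (Prod.Lex.prodLexCongr e₂ e)⟩⟩

open Classical in
theorem mem_OGToEps_iff (ε : Fin 2) :
    ε ∈ OGToEps G ↔ ε = if Scattered (Set.univ : Set G.Elem) then 0 else 1 := by
  have key : ∀ ε' ∈ OGToEps G, ε' = if Scattered (Set.univ : Set G.Elem) then 0 else 1 := by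
    rintro ε' ⟨X, _, _, h⟩
    have := h.eq_ite
    split_ifs with hs
    · exact this.2 hs
    · have := mt this.1 hs
      omega
  refine ⟨key ε, ?_⟩
  rintro rfl
  obtain ⟨ε', h⟩ := G.exists_hasOrderType
  exact key ε' h ▸ h

theorem existsUnique_mem_OGToEps : ∃! ε, ε ∈ OGToEps G := by
  classical
  exact ⟨_, (G.mem_OGToEps_iff _).2 rfl, fun ε h => (G.mem_OGToEps_iff ε).1 h⟩

theorem mem_dom_OGToEps : G ∈ OGToEps.dom := G.existsUnique_mem_OGToEps.exists

end CountableOrderedGroup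

/-! ### The Kleene–Brouwer order -/

theorem initSeg_succ (x : ℕ → ℕ) (n : ℕ) : initSeg x (n + 1) = initSeg x n ++ [x n] := by
  simp [initSeg, List.range_succ]

@[simp] theorem length_initSeg (x : ℕ → ℕ) (n : ℕ) : (initSeg x n).length = n := by
  simp [initSeg]

theorem getD_initSeg {x : ℕ → ℕ} {n i : ℕ} (h : i < n) : (initSeg x n).getD i 0 = x i := by
  simp [initSeg, h]

/-- A property of finite strings that can always be kept by appending an entry holds along a
path. -/
theorem exists_forall_initSeg {P : List ℕ → Prop} (h0 : P [])
    (h : ∀ σ, P σ → ∃ a, P (σ ++ [a])) : ∃ x : ℕ → ℕ, ∀ n, P (initSeg x n) := by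
  choose a ha using h
  let s : ℕ → {σ // P σ} := fun n =>
    Nat.rec ⟨[], h0⟩ (fun _ σ => ⟨σ.1 ++ [a σ.1 σ.2], ha σ.1 σ.2⟩) n
  let x : ℕ → ℕ := fun n => a (s n).1 (s n).2
  have hs : ∀ n, initSeg x n = (s n).1 := by
    intro n
    induction n with
    | zero => rfl
    | succ n ih => rw [initSeg_succ, ih]
  exact ⟨x, fun n => hs n ▸ (s n).2⟩

/-- The finite strings of natural numbers with the Kleene–Brouwer order: the lexicographic order
in which the end of a string counts as larger than all entries. -/
def KleeneBrouwer : Type := List ℕ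

namespace KleeneBrouwer

/-- The string, extended by `⊤`. -/
def toSeq (σ : List ℕ) (i : ℕ) : WithTop ℕ := σ[i]?.elim ⊤ (↑)

theorem toSeq_eq_iff {σ τ : List ℕ} {i : ℕ} : toSeq σ i = toSeq τ i ↔ σ[i]? = τ[i]? := by
  unfold toSeq
  cases σ[i]? <;> cases τ[i]? <;> simp

theorem toSeq_lt_iff {σ τ : List ℕ} {i : ℕ} : toSeq σ i < toSeq τ i ↔
    i < σ.length ∧ (τ.length ≤ i ∨ σ.getD i 0 < τ.getD i 0) := by
  unfold toSeq
  rcases lt_or_ge i σ.length with h | h <;> rcases lt_or_ge i τ.length with h' | h' <;>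
    simp [h, h']

theorem toSeq_injective : Function.Injective toSeq := fun _ _ h =>
  List.ext_getElem? fun i => toSeq_eq_iff.1 (congrFun h i)

noncomputable instance : LinearOrder KleeneBrouwer :=
  LinearOrder.lift' (fun σ => toLex (toSeq σ)) fun _ _ h => toSeq_injective (toLex.injective h)

instance : Encodable KleeneBrouwer := inferInstanceAs (Encodable (List ℕ))

/-- The Kleene–Brouwer order on strings. -/
def Lt (σ τ : List ℕ) : Prop := (show KleeneBrouwer from σ) < (show KleeneBrouwer from τ)

/-- All quantifiers are bounded by the length of `σ`, which makes the order primitive recursive. -/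
theorem lt_iff {σ τ : List ℕ} : Lt σ τ ↔
    ∃ i < σ.length, (∀ j < i, σ[j]? = τ[j]?) ∧ (τ.length ≤ i ∨ σ.getD i 0 < τ.getD i 0) := by
  change (∃ i, (∀ j < i, toSeq σ j = toSeq τ j) ∧ toSeq σ i < toSeq τ i) ↔ _
  simp only [toSeq_eq_iff, toSeq_lt_iff]
  exact exists_congr fun i => by tauto

theorem Lt.trans {σ τ υ : List ℕ} (h : Lt σ τ) (h' : Lt τ υ) : Lt σ υ :=
  lt_trans (α := KleeneBrouwer) h h'

theorem Lt.irrefl {σ : List ℕ} (h : Lt σ σ) : False := lt_irrefl (α := KleeneBrouwer) _ h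

/-- A proper extension of a string precedes it. -/
theorem append_lt (σ τ : List ℕ) (a : ℕ) : Lt (σ ++ a :: τ) σ :=
  lt_iff.2 ⟨σ.length, by simp, fun j hj => List.getElem?_append_left hj, Or.inl le_rfl⟩

theorem append_cons_lt_append_cons (σ τ υ : List ℕ) {a b : ℕ} (h : a < b) :
    Lt (σ ++ a :: τ) (σ ++ b :: υ) :=
  lt_iff.2 ⟨σ.length, by simp, fun j hj => by
    rw [List.getElem?_append_left hj, List.getElem?_append_left hj], Or.inr (by simpa using h)⟩

/-- Any extension of `τ` is below `τ`. Appending an entry larger than `σ i` keeps it above `σ` even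
if `τ` ends at the deciding position `i`. -/
instance : DenselyOrdered KleeneBrouwer := by
  refine ⟨fun (σ τ : List ℕ) h => ?_⟩
  obtain ⟨i, hi, hj, h'⟩ := lt_iff.1 h
  refine ⟨show List ℕ from τ ++ [σ.getD i 0 + 1], ?_, append_lt _ _ _⟩
  have hiτ : i ≤ τ.length := by
    by_contra! hlt
    have h1 := hj τ.length hlt
    simp [hlt.trans hi] at h1
  refine lt_iff.2 ⟨i, hi, fun j hji => ?_, Or.inr ?_⟩
  · rw [List.getElem?_append_left (hji.trans_le hiτ), hj j hji]
  · rcases hiτ.eq_or_lt with rfl | hlt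
    · simp
    · rcases h' with h' | h'
      · omega
      · rwa [List.getD_append _ _ _ _ hlt]

instance : Nontrivial KleeneBrouwer := ⟨show List ℕ from [], show List ℕ from [0], by
  intro h; simpa using congrArg List.length (show ([] : List ℕ) = [0] from h)⟩

end KleeneBrouwer

theorem BaireTree.mem_of_prefix {T : BaireTree} {σ τ : List ℕ} (h : σ <+: τ) (hτ : τ ∈ T.1) :
    σ ∈ T.1 :=
  Descriptive.Tree.mem_of_prefix h hτ

open KleeneBrouwer in
/-- A tree has a path if and only if it is not well-ordered by the Kleene–Brouwer order. -/
theorem BaireTree.illFounded_iff (T : BaireTree) : T.IllFounded ↔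
    ∃ S : Set (List ℕ), S.Nonempty ∧ (∀ σ ∈ S, σ ∈ T.1) ∧ ∀ σ ∈ S, ∃ τ ∈ S, Lt τ σ := by
  constructor
  · rintro ⟨x, hx⟩
    refine ⟨Set.range (initSeg x), ⟨_, 0, rfl⟩, ?_, ?_⟩
    · rintro _ ⟨n, rfl⟩
      exact hx n
    · rintro _ ⟨n, rfl⟩
      refine ⟨_, ⟨n + 1, rfl⟩, ?_⟩
      rw [initSeg_succ]
      exact append_lt _ _ _
  · rintro ⟨S, ⟨σ₀, hσ₀⟩, hST, hS⟩
    -- `ρ` begins some element of `S`, and every element of `S` either extends `ρ` or is above all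
    -- extensions of `ρ`: the leftmost branch through `S`.
    let P : List ℕ → Prop := fun ρ => (∃ σ ∈ S, ρ <+: σ) ∧
      ∀ σ ∈ S, ρ <+: σ ∨ ∀ ρ', ρ <+: ρ' → Lt ρ' σ
    have h0 : P [] := ⟨⟨σ₀, hσ₀, List.nil_prefix⟩, fun σ _ => Or.inl List.nil_prefix⟩
    obtain ⟨x, hx⟩ := exists_forall_initSeg h0 (by
      rintro ρ ⟨⟨σ, hσ, hρσ⟩, hρ⟩
      have hex : ∃ a, ∃ τ ∈ S, ρ ++ [a] <+: τ := by
        -- If `ρ` itself is in `S`, a smaller element of `S` cannot be above `ρ`, so it properly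
        -- extends `ρ`.
        obtain ⟨τ, hτ, hτσ⟩ : ∃ τ ∈ S, ρ <+: τ ∧ τ ≠ ρ := by
          by_cases h : σ = ρ
          · obtain ⟨τ, hτ, hlt⟩ := hS σ hσ
            rw [h] at hlt
            refine ⟨τ, hτ, (hρ τ hτ).resolve_right fun h' => ?_, ?_⟩
            · exact (hlt.trans (h' ρ List.prefix_rfl)).irrefl
            · rintro rfl
              exact hlt.irrefl
          · exact ⟨σ, hσ, hρσ, h⟩
        obtain ⟨⟨υ, rfl⟩, hne⟩ := hτσ
        cases υ with
        | nil => simp at hne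
        | cons a υ => exact ⟨a, _, hτ, υ, by simp⟩
      classical
      -- The least possible next entry keeps the branch leftmost.
      refine ⟨Nat.find hex, Nat.find_spec hex, fun τ hτ => ?_⟩
      rcases hρ τ hτ with ⟨υ, rfl⟩ | h
      · cases υ with
        | nil =>
          refine Or.inr ?_
          rintro _ ⟨υ, rfl⟩
          simpa using append_lt ρ υ _
        | cons b υ =>
          rcases (Nat.find_min' hex ⟨_, hτ, υ, by simp⟩ : Nat.find hex ≤ b).eq_or_lt with h | h
          · refine Or.inl ⟨υ, by simp [h]⟩
          · refine Or.inr ?_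
            rintro _ ⟨υ', rfl⟩
            simpa using append_cons_lt_append_cons ρ υ' υ h
      · exact Or.inr fun ρ' hρ' => h ρ' ((List.prefix_append _ _).trans hρ'))
    refine ⟨x, fun n => ?_⟩
    obtain ⟨σ, hσ, h⟩ := (hx n).1
    exact T.mem_of_prefix h (hST σ hσ)

/-! ### Computable functionals -/

/-- A total functional whose `n`-th output is computed from the first `b n` inputs. -/
theorem isComputableFunctional_of_bounded {f : ℕ → List ℕ → ℕ} {b : ℕ → ℕ} (hf : Primrec₂ f)
    (hb : Primrec b) (hmono : Monotone b) :
    IsComputableFunctional fun x => Part.some fun n => f n (initSeg x (b n)) := by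
  -- With `l` inputs, the outputs of index below `N l` are determined. Capping the search at `l`
  -- loses nothing in the limit, because `N (max n (b n)) ≥ n`.
  let N : ℕ → ℕ := fun l => Nat.findGreatest (fun n => b n ≤ l) l
  let g : List ℕ → List ℕ := fun σ => (List.range (N σ.length)).map fun n => f n (σ.take (b n))
  have hN : Primrec N := Primrec.nat_findGreatest Primrec.id
    (Primrec.nat_le.comp (hb.comp Primrec.snd) Primrec.fst)
  have hg : Primrec g := Primrec.list_map
    (Primrec.list_range.comp (hN.comp Primrec.list_length))
    (hf.comp Primrec.snd (Primrec.list_take.comp (hb.comp Primrec.snd) Primrec.fst))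
  have hbN : ∀ {n l}, n < N l → b n ≤ l := by
    intro n l hn
    refine (hmono hn.le).trans ?_
    exact Nat.findGreatest_of_ne_zero (P := fun n => b n ≤ l) rfl (by omega)
  have hNmono : Monotone N := fun l l' h => Nat.findGreatest_mono (fun n hn => hn.trans h) h
  have hNle : ∀ n, n ≤ N (max n (b n)) := fun n =>
    Nat.le_findGreatest (le_max_left _ _) (le_max_right _ _)
  have hgx : ∀ x m, g (initSeg x m) = initSeg (fun n => f n (initSeg x (b n))) (N m) := by
    intro x m
    simp only [g, length_initSeg]
    refine List.map_congr_left fun n hn => ?_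
    have := hbN (List.mem_range.1 hn)
    simp [initSeg, List.take_range, ← List.map_take, this]
  have hpre : ∀ (y : ℕ → ℕ) {m n}, m ≤ n → initSeg y m <+: initSeg y n := by
    intro y m n h
    obtain ⟨k, rfl⟩ := Nat.exists_eq_add_of_le h
    simp [initSeg, List.range_add]
  refine ⟨g, hg.to_comp, ?_, fun x y => ?_⟩
  · rintro σ _ ⟨τ, rfl⟩
    have h : N σ.length ≤ N (σ ++ τ).length := hNmono (by simp)
    obtain ⟨k, hk⟩ := Nat.exists_eq_add_of_le h
    simp only [g, hk, List.range_add, List.map_append]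
    refine ⟨_, congrArg (· ++ _) (List.map_congr_left fun n hn => ?_)⟩
    rw [List.take_append_of_le_length (hbN (List.mem_range.1 hn))]
  · rw [Part.mem_some_iff]
    constructor
    · rintro rfl n
      exact ⟨_, (hgx x _) ▸ hpre _ (hNle n)⟩
    · intro h
      funext n
      obtain ⟨m, hm⟩ := h (n + 1)
      rw [hgx] at hm
      have h1 := hm.length_le
      have h2 := List.IsPrefix.getElem hm (i := n) (by simp)
      simpa [initSeg] using h2

/-- This recovers `q` from `joinSeq p q`. -/
theorem isComputableFunctional_snd :
    IsComputableFunctional fun x => Part.some fun n => x (2 * n + 1) := by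
  have := isComputableFunctional_of_bounded (f := fun n ρ => ρ.getD (2 * n + 1) 0)
    (b := fun n => 2 * n + 2)
    ((Primrec.list_getD 0).comp Primrec.snd (Primrec.succ.comp
      (Primrec.nat_mul.comp (Primrec.const 2) Primrec.fst)))
    (Primrec.nat_add.comp (Primrec.nat_mul.comp (Primrec.const 2) Primrec.id) (Primrec.const 2))
    (fun m n h => by dsimp only; omega)
  simpa only [getD_initSeg (Nat.lt_succ_self _)] using this

/-- A Weihrauch reduction whose backward functional returns the answer unchanged. -/
theorem weihrauchLE_of_forward {X Y Z : Type*} [RepresentedSpace X] [RepresentedSpace Y]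
    [RepresentedSpace Z] {f : Problem X Y} {g : Problem Z Y} (F : (ℕ → ℕ) → ℕ → ℕ)
    (hF : IsComputableFunctional fun x => Part.some (F x))
    (h : ∀ p x, IsName p x → x ∈ f.dom → ∃ z, IsName (F p) z ∧ z ∈ g.dom ∧ g z ⊆ f x) :
    WeihrauchLE f g := by
  refine ⟨_, _, hF, isComputableFunctional_snd, fun p x hp hx => ?_⟩
  obtain ⟨z, hz, hzd, hzx⟩ := h p x hp hx
  refine ⟨_, Part.mem_some _, z, hz, hzd, fun q w hq hw => ⟨_, Part.mem_some _, w, ?_, hzx hw⟩⟩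
  convert hq using 1
  funext n
  simp only [joinSeq]
  rw [if_neg (by omega)]
  congr 1
  omega

/-! ### Bounds for codes -/

/-- It bounds the positions of a name that must be read to decide a property of a coded list. -/
theorem le_encode_of_mem {α : Type*} [Encodable α] {l : List α} {a : α} (h : a ∈ l) :
    Encodable.encode a < Encodable.encode l := by
  induction l with
  | nil => simp at h
  | cons b l ih =>
    rw [Encodable.encode_list_cons, Nat.lt_succ_iff]
    rcases List.mem_cons.1 h with rfl | h
    · exact Nat.left_le_pair _ _
    · exact (ih h).le.trans (Nat.right_le_pair _ _)

theorem pair_le_pair {a b c d : ℕ} (h : a ≤ c) (h' : b ≤ d) : Nat.pair a b ≤ Nat.pair c d := by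
  refine le_trans (b := Nat.pair c b) ?_ ?_
  · rcases h.eq_or_lt with rfl | h
    · rfl
    · exact (Nat.pair_lt_pair_left b h).le
  · rcases h'.eq_or_lt with rfl | h'
    · rfl
    · exact (Nat.pair_lt_pair_right c h').le

theorem KleeneBrouwer.primrecRel_lt : PrimrecRel KleeneBrouwer.Lt := by
  have h1 : PrimrecRel fun (j : ℕ) (p : List ℕ × List ℕ) => p.1[j]? = p.2[j]? :=
    Primrec.eq.comp
      (Primrec.list_getElem?.comp (Primrec.fst.comp Primrec.snd) Primrec.fst)
      (Primrec.list_getElem?.comp (Primrec.snd.comp Primrec.snd) Primrec.fst)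
  have h2 : PrimrecRel fun (i : ℕ) (p : List ℕ × List ℕ) => ∀ j < i, p.1[j]? = p.2[j]? :=
    (h1.forall_mem_list.comp (Primrec.list_range.comp Primrec.fst) Primrec.snd).of_eq (by simp)
  have h3 : PrimrecRel fun (i : ℕ) (p : List ℕ × List ℕ) =>
      p.2.length ≤ i ∨ p.1.getD i 0 < p.2.getD i 0 :=
    (Primrec.nat_le.comp (Primrec.list_length.comp (Primrec.snd.comp Primrec.snd))
      Primrec.fst).or
    (Primrec.nat_lt.comp ((Primrec.list_getD 0).comp (Primrec.fst.comp Primrec.snd) Primrec.fst)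
      ((Primrec.list_getD 0).comp (Primrec.snd.comp Primrec.snd) Primrec.fst))
  have h4 : PrimrecRel fun (i : ℕ) (p : List ℕ × List ℕ) => (∀ j < i, p.1[j]? = p.2[j]?) ∧
      (p.2.length ≤ i ∨ p.1.getD i 0 < p.2.getD i 0) := PrimrecPred.and h2 h3
  refine (h4.exists_mem_list.comp (Primrec.list_range.comp (Primrec.list_length.comp Primrec.fst))
    Primrec.id).of_eq fun p => ?_
  rw [KleeneBrouwer.lt_iff]
  simp

/-! ### Reducing `OG ↦ ε` to `WF` -/

open Encodable Denumerable

namespace CountableOrderedGroup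

variable (G : CountableOrderedGroup)

/-- If `a` and `b` are elements of `G`, then `a` is strictly below `b`. -/
def Below (a b : ℕ) : Prop :=
  ∀ (ha : a ∈ G.carrier) (hb : b ∈ G.carrier), ¬ G.order.le ⟨b, hb⟩ ⟨a, ha⟩

/-- The tree of finite attempts to embed the Kleene–Brouwer order into `G`. -/
def embeddingTree : BaireTree :=
  -- The entry of `σ` at position `i` is the intended image of the string with number `i`.
  ⟨⟨{σ | (∀ a ∈ σ, a ∈ G.carrier) ∧ ∀ i < σ.length, ∀ j < σ.length,
      KleeneBrouwer.Lt (ofNat (List ℕ) i) (ofNat (List ℕ) j) →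
        G.Below (σ.getD i 0) (σ.getD j 0)}, by
    rintro σ a ⟨h1, h2⟩
    refine ⟨fun b hb => h1 b (List.mem_append_left _ hb), fun i hi j hj hij => ?_⟩
    have := h2 i (by simp; omega) j (by simp; omega) hij
    rwa [List.getD_append _ _ _ _ hi, List.getD_append _ _ _ _ hj] at this⟩,
   [], by simp, by simp⟩

theorem mem_embeddingTree {σ : List ℕ} : σ ∈ G.embeddingTree.1 ↔ (∀ a ∈ σ, a ∈ G.carrier) ∧
    ∀ i < σ.length, ∀ j < σ.length,
      KleeneBrouwer.Lt (ofNat (List ℕ) i) (ofNat (List ℕ) j) →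
        G.Below (σ.getD i 0) (σ.getD j 0) := Iff.rfl

/-- A path is a strictly increasing map from the Kleene–Brouwer order to `G`. That order is dense
and nontrivial, so its image witnesses non-scatteredness; conversely, being countable, it embeds
into any nontrivial dense subset of `G`. -/
theorem illFounded_embeddingTree_iff :
    G.embeddingTree.IllFounded ↔ ¬ Scattered (Set.univ : Set G.Elem) := by
  constructor
  · rintro ⟨x, hx⟩ hG
    have hC : ∀ n, x n ∈ G.carrier := fun n =>
      (hx (n + 1)).1 _ (by rw [initSeg_succ]; simp)
    let e : KleeneBrouwer → G.Elem := fun σ => ⟨x (encode (show List ℕ from σ)), hC _⟩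
    have he : StrictMono e := by
      intro (σ : List ℕ) (τ : List ℕ) h
      have := (hx (max (encode σ) (encode τ) + 1)).2 (encode σ) (by simp) (encode τ) (by simp)
        (by rw [ofNat_encode, ofNat_encode]; exact h)
      rw [getD_initSeg (by omega), getD_initSeg (by omega)] at this
      exact lt_of_not_ge (this (hC _) (hC _))
    have := (hG.of_mapsTo e he (Set.mapsTo_univ _ _)).subsingleton_of_denselyOrdered
    exact false_of_nontrivial_of_subsingleton KleeneBrouwer
  · intro hG
    unfold Scattered at hG
    push Not at hG
    obtain ⟨D, -, hn, hD⟩ := hG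
    have : Nontrivial D := hn.coe_sort
    have : DenselyOrdered D := ⟨fun x y h => by
      obtain ⟨z, hz, h1, h2⟩ := hD x x.2 y y.2 h
      exact ⟨⟨z, hz⟩, h1, h2⟩⟩
    obtain ⟨e⟩ := Order.embedding_from_countable_to_dense KleeneBrouwer D
    let x : ℕ → ℕ := fun n => (show G.carrier from (e (ofNat (List ℕ) n)).1).1
    have hxC : ∀ n, x n ∈ G.carrier := fun n => (show G.carrier from (e (ofNat (List ℕ) n)).1).2
    refine ⟨x, fun n => ⟨fun a ha => ?_, fun i hi j hj hij => ?_⟩⟩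
    · obtain ⟨k, -, rfl⟩ := List.mem_map.1 ha
      exact hxC k
    · rw [length_initSeg] at hi hj
      rw [getD_initSeg hi, getD_initSeg hj]
      exact fun _ _ => (show (e (ofNat (List ℕ) i)).1 < (e (ofNat (List ℕ) j)).1 from
        e.strictMono hij).not_ge

end CountableOrderedGroup

/-- The membership test for the embedding tree, reading the name of the group from `ρ`. -/
def EmbeddingTest (σ ρ : List ℕ) : Prop :=
  (∀ a ∈ σ, ρ.getD (Nat.pair 0 a) 0 = 1) ∧ ∀ i < σ.length, ∀ j < σ.length,
    KleeneBrouwer.Lt (ofNat (List ℕ) i) (ofNat (List ℕ) j) →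
      -- The value `0` says that the `j`-th image is not `≤` the `i`-th, as in `Below`.
      ρ.getD (Nat.pair 2 (Nat.pair (σ.getD j 0) (σ.getD i 0))) 0 = 0

theorem primrecRel_embeddingTest : PrimrecRel EmbeddingTest := by
  have h1 : PrimrecRel fun (σ ρ : List ℕ) => ∀ a ∈ σ, ρ.getD (Nat.pair 0 a) 0 = 1 := by
    refine PrimrecRel.forall_mem_list (R := fun (a : ℕ) (ρ : List ℕ) =>
      ρ.getD (Nat.pair 0 a) 0 = 1) ?_
    exact Primrec.eq.comp ((Primrec.list_getD 0).comp Primrec.snd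
      (Primrec₂.natPair.comp (Primrec.const 0) Primrec.fst)) (Primrec.const 1)
  let Q : ℕ → ℕ × List ℕ × List ℕ → Prop := fun j p =>
    KleeneBrouwer.Lt (ofNat (List ℕ) p.1) (ofNat (List ℕ) j) →
      p.2.2.getD (Nat.pair 2 (Nat.pair (p.2.1.getD j 0) (p.2.1.getD p.1 0))) 0 = 0
  have hQ : PrimrecRel Q := by
    have ha : PrimrecPred fun q : ℕ × ℕ × List ℕ × List ℕ =>
        KleeneBrouwer.Lt (ofNat (List ℕ) q.2.1) (ofNat (List ℕ) q.1) :=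
      KleeneBrouwer.primrecRel_lt.comp
        ((Primrec.ofNat _).comp (Primrec.fst.comp Primrec.snd))
        ((Primrec.ofNat _).comp Primrec.fst)
    have hσ : Primrec fun q : ℕ × ℕ × List ℕ × List ℕ => q.2.2.1 :=
      Primrec.fst.comp (Primrec.snd.comp Primrec.snd)
    have hρ : Primrec fun q : ℕ × ℕ × List ℕ × List ℕ => q.2.2.2 :=
      Primrec.snd.comp (Primrec.snd.comp Primrec.snd)
    have hb : PrimrecPred fun q : ℕ × ℕ × List ℕ × List ℕ =>
        q.2.2.2.getD (Nat.pair 2 (Nat.pair (q.2.2.1.getD q.1 0) (q.2.2.1.getD q.2.1 0))) 0 = 0 :=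
      Primrec.eq.comp ((Primrec.list_getD 0).comp hρ
        (Primrec₂.natPair.comp (Primrec.const 2) (Primrec₂.natPair.comp
          ((Primrec.list_getD 0).comp hσ Primrec.fst)
          ((Primrec.list_getD 0).comp hσ (Primrec.fst.comp Primrec.snd))))) (Primrec.const 0)
    exact (ha.not.or hb).of_eq fun q => (imp_iff_not_or).symm
  have h2 : PrimrecRel fun (i : ℕ) (p : List ℕ × List ℕ) =>
      ∀ j ∈ List.range p.1.length, Q j (i, p) :=
    hQ.forall_mem_list.comp
      (Primrec.list_range.comp (Primrec.list_length.comp (Primrec.fst.comp Primrec.snd)))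
      Primrec.id
  have h3 : PrimrecPred fun p : List ℕ × List ℕ =>
      ∀ i ∈ List.range p.1.length, ∀ j ∈ List.range p.1.length, Q j (i, p) :=
    h2.forall_mem_list.comp (Primrec.list_range.comp (Primrec.list_length.comp Primrec.fst))
      Primrec.id
  exact (PrimrecPred.and h1 h3).of_eq fun p => by simp [EmbeddingTest, Q]

open Classical in
/-- The characteristic function of the embedding tree. -/
noncomputable def embeddingFunctional (p : ℕ → ℕ) (n : ℕ) : ℕ :=
  -- The entries of the string with code `n` are less than `n`, so every queried position is at most
  -- `Nat.pair 2 (Nat.pair n n)`.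
  if EmbeddingTest (ofNat (List ℕ) n) (initSeg p (Nat.pair 2 (Nat.pair n n) + 1)) then 1 else 0

theorem isComputableFunctional_embeddingFunctional :
    IsComputableFunctional fun x => Part.some (embeddingFunctional x) := by
  classical
  refine isComputableFunctional_of_bounded
    (f := fun n ρ => if EmbeddingTest (ofNat (List ℕ) n) ρ then 1 else 0)
    (b := fun n => Nat.pair 2 (Nat.pair n n) + 1) ?_ ?_ ?_
  · exact Primrec.ite (primrecRel_embeddingTest.comp ((Primrec.ofNat _).comp Primrec.fst)
      Primrec.snd) (Primrec.const 1) (Primrec.const 0)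
  · exact Primrec.succ.comp (Primrec₂.natPair.comp (Primrec.const 2)
      (Primrec₂.natPair.comp Primrec.id Primrec.id))
  · exact fun m n h => Nat.succ_le_succ (pair_le_pair le_rfl (pair_le_pair h h))

theorem isName_embeddingTree {p : ℕ → ℕ} {G : CountableOrderedGroup} (h : G.Codes p) :
    IsName (embeddingFunctional p) G.embeddingTree := by
  classical
  intro σ
  obtain ⟨h0, -, h2⟩ := h
  have hmem : ∀ a ∈ σ, a < encode σ := fun a ha => le_encode_of_mem ha
  have hget : ∀ i < σ.length, σ.getD i 0 ∈ σ := fun i hi => by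
    rw [List.getD_eq_getElem _ _ hi]
    exact List.getElem_mem hi
  unfold embeddingFunctional
  congr 1
  rw [ofNat_encode, G.mem_embeddingTree, EmbeddingTest, eq_iff_iff]
  have hC : (∀ a ∈ σ, (initSeg p (Nat.pair 2 (Nat.pair (encode σ) (encode σ)) + 1)).getD
      (Nat.pair 0 a) 0 = 1) ↔ ∀ a ∈ σ, a ∈ G.carrier := by
    refine forall₂_congr fun a ha => ?_
    rw [getD_initSeg (Nat.lt_succ_of_le (pair_le_pair (Nat.zero_le _)
      ((hmem a ha).le.trans (Nat.left_le_pair _ _)))), h0]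
    simp
  rw [hC]
  refine and_congr_right fun hCσ => forall₂_congr fun i hi => forall₂_congr fun j hj =>
    imp_congr_right fun _ => ?_
  have hi' := hget i hi
  have hj' := hget j hj
  rw [getD_initSeg (Nat.lt_succ_of_le (pair_le_pair le_rfl (pair_le_pair (hmem _ hj').le
    (hmem _ hi').le)))]
  have := h2 ⟨_, hCσ _ hj'⟩ ⟨_, hCσ _ hi'⟩
  dsimp only at this
  rw [this, ite_eq_right_iff]
  exact ⟨fun h _ _ hle => one_ne_zero (h hle), fun h hle => absurd hle (h _ _)⟩

theorem OGToEps_le_WF : WeihrauchLE OGToEps WF := by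
  refine weihrauchLE_of_forward embeddingFunctional isComputableFunctional_embeddingFunctional
    fun p G hp _ => ⟨G.embeddingTree, isName_embeddingTree hp, ⟨_, rfl⟩, ?_⟩
  classical
  rintro _ rfl
  rw [G.mem_OGToEps_iff, G.illFounded_embeddingTree_iff]
  split_ifs <;> simp_all

/-! ### Reducing `WF` to `OG ↦ ε` -/

/-- A formal difference of two multisets of finite strings. -/
abbrev FormalDiff := List (List ℕ) × List (List ℕ)

/-! ### Primitive recursive arithmetic in `ℤ ^ KleeneBrouwer` -/

namespace FormalDiff

/-- The coefficients of a formal difference. -/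
noncomputable def coeff (w : FormalDiff) : List ℕ →₀ ℤ :=
  Finsupp.onFinset (w.1 ++ w.2).toFinset (fun k => w.1.count k - w.2.count k) (fun k h => by
    by_contra hk
    simp only [List.toFinset_append, Finset.mem_union, List.mem_toFinset, not_or] at hk
    simp [List.count_eq_zero_of_not_mem hk.1, List.count_eq_zero_of_not_mem hk.2] at h)

theorem coeff_apply (w : FormalDiff) (k : List ℕ) :
    w.coeff k = w.1.count k - w.2.count k := rfl

theorem coeff_append (v w : FormalDiff) :
    coeff (v.1 ++ w.1, v.2 ++ w.2) = v.coeff + w.coeff := by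
  ext k
  simp only [coeff_apply, List.count_append, Finsupp.add_apply]
  push_cast
  ring

theorem coeff_surjective : Function.Surjective coeff := by
  intro f
  induction f using Finsupp.induction_linear with
  | zero => exact ⟨([], []), by ext k; simp [coeff_apply]⟩
  | add f g hf hg =>
    obtain ⟨v, rfl⟩ := hf
    obtain ⟨w, rfl⟩ := hg
    exact ⟨_, coeff_append v w⟩
  | single k n =>
    refine ⟨(List.replicate n.toNat k, List.replicate (-n).toNat k), ?_⟩
    ext j
    rw [coeff_apply]
    rcases eq_or_ne j k with rfl | h
    · simp only [List.count_replicate_self, Finsupp.single_eq_same]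
      omega
    · simp [List.count_replicate, h, h.symm]

/-- The element of `ℤ ^ KleeneBrouwer` denoted by a formal difference. -/
noncomputable def toColex (w : FormalDiff) : Colex (KleeneBrouwer →₀ ℤ) :=
  _root_.toColex (show KleeneBrouwer →₀ ℤ from w.coeff)

/-- The comparison of multisets of strings at the last string where they differ. -/
def ListLt (P Q : List (List ℕ)) : Prop :=
  ∃ k ∈ Q, P.count k < Q.count k ∧ ∀ j ∈ P ++ Q, KleeneBrouwer.Lt k j → P.count j = Q.count j

/-- Moving the subtracted multisets to the other side leaves only counts. Strings outside both lists
have count zero, so bounded quantifiers suffice. -/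
theorem toColex_lt_iff {v w : FormalDiff} :
    v.toColex < w.toColex ↔ ListLt (v.1 ++ w.2) (w.1 ++ v.2) := by
  rw [Finsupp.colex_lt_iff]
  change (∃ k : List ℕ, (∀ j : List ℕ, KleeneBrouwer.Lt k j → v.coeff j = w.coeff j) ∧
    v.coeff k < w.coeff k) ↔ _
  refine exists_congr fun k => ?_
  have hlt : ∀ k, v.coeff k < w.coeff k ↔ (v.1 ++ w.2).count k < (w.1 ++ v.2).count k := by
    intro k
    simp only [coeff_apply, List.count_append]
    omega
  have heq : ∀ k, v.coeff k = w.coeff k ↔ (v.1 ++ w.2).count k = (w.1 ++ v.2).count k := by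
    intro k
    simp only [coeff_apply, List.count_append]
    omega
  rw [hlt]
  simp only [heq]
  generalize v.1 ++ w.2 = P
  generalize w.1 ++ v.2 = Q
  constructor
  · rintro ⟨h1, h2⟩
    exact ⟨List.count_pos_iff.1 (by omega), h2, fun j _ => h1 j⟩
  · rintro ⟨-, h2, h1⟩
    refine ⟨fun j hj => ?_, h2⟩
    by_cases hm : j ∈ P ++ Q
    · exact h1 j hm hj
    · rw [List.mem_append, not_or] at hm
      rw [List.count_eq_zero_of_not_mem hm.1, List.count_eq_zero_of_not_mem hm.2]

theorem _root_.Primrec.list_count {α : Type*} [Primcodable α] [BEq α] [LawfulBEq α] :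
    Primrec₂ fun (k : α) (l : List α) => l.count k := by
  classical
  have : Primrec₂ fun (l : List α) (k : α) => l.filter (fun a => a = k) :=
    PrimrecRel.listFilter Primrec.eq
  refine (Primrec.list_length.comp (this.comp Primrec.snd Primrec.fst)).of_eq fun p => ?_
  change _ = List.count p.1 p.2
  rw [List.count_eq_countP, List.countP_eq_length_filter]
  congr 2
  funext a
  rw [Bool.eq_iff_iff]
  simp

theorem primrecRel_listLt : PrimrecRel ListLt := by
  have hc : ∀ {α : Type} [Primcodable α] {f : α → List ℕ} {g : α → List (List ℕ)},
      Primrec f → Primrec g → Primrec fun a => (g a).count (f a) :=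
    fun hf hg => Primrec.list_count.comp hf hg
  let Q₁ : List ℕ → List ℕ × List (List ℕ) × List (List ℕ) → Prop := fun j p =>
    KleeneBrouwer.Lt p.1 j → p.2.1.count j = p.2.2.count j
  have h1 : PrimrecRel Q₁ := by
    have ha : PrimrecPred fun q : List ℕ × List ℕ × List (List ℕ) × List (List ℕ) =>
        KleeneBrouwer.Lt q.2.1 q.1 :=
      KleeneBrouwer.primrecRel_lt.comp (Primrec.fst.comp Primrec.snd) Primrec.fst
    have hb : PrimrecPred fun q : List ℕ × List ℕ × List (List ℕ) × List (List ℕ) =>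
        q.2.2.1.count q.1 = q.2.2.2.count q.1 :=
      Primrec.eq.comp (hc Primrec.fst (Primrec.fst.comp (Primrec.snd.comp Primrec.snd)))
        (hc Primrec.fst (Primrec.snd.comp (Primrec.snd.comp Primrec.snd)))
    exact (ha.not.or hb).of_eq fun q => (imp_iff_not_or).symm
  have h2 : PrimrecRel fun (k : List ℕ) (p : List (List ℕ) × List (List ℕ)) =>
      p.1.count k < p.2.count k ∧ ∀ j ∈ p.1 ++ p.2, Q₁ j (k, p) :=
    PrimrecPred.and
      (Primrec.nat_lt.comp (hc Primrec.fst (Primrec.fst.comp Primrec.snd))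
        (hc Primrec.fst (Primrec.snd.comp Primrec.snd)))
      (h1.forall_mem_list.comp (Primrec.list_append.comp (Primrec.fst.comp Primrec.snd)
        (Primrec.snd.comp Primrec.snd)) Primrec.id)
  exact h2.exists_mem_list.comp Primrec.snd Primrec.id

/-- The element of `ℤ ^ KleeneBrouwer` with code `m`. -/
noncomputable def value (m : ℕ) : Colex (KleeneBrouwer →₀ ℤ) := (ofNat FormalDiff m).toColex

theorem value_surjective : Function.Surjective value := by
  intro f
  obtain ⟨w, hw⟩ := coeff_surjective (ofColex f)
  refine ⟨encode w, ?_⟩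
  rw [value, ofNat_encode, toColex, hw]
  rfl

theorem primrec_ofNat : Primrec (ofNat FormalDiff) := Primrec.ofNat _

theorem primrecRel_value_lt : PrimrecRel fun m n => value m < value n := by
  refine PrimrecPred.of_eq ?_ fun p : ℕ × ℕ => toColex_lt_iff.symm
  have h1 : Primrec fun p : ℕ × ℕ => ofNat FormalDiff p.1 := primrec_ofNat.comp Primrec.fst
  have h2 : Primrec fun p : ℕ × ℕ => ofNat FormalDiff p.2 := primrec_ofNat.comp Primrec.snd
  exact primrecRel_listLt.comp
    (Primrec.list_append.comp (Primrec.fst.comp h1) (Primrec.snd.comp h2))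
    (Primrec.list_append.comp (Primrec.fst.comp h2) (Primrec.snd.comp h1))

theorem primrecRel_value_le : PrimrecRel fun m n => value m ≤ value n :=
  (primrecRel_value_lt.comp Primrec.snd Primrec.fst).not.of_eq fun _ => not_lt

theorem primrecRel_value_eq : PrimrecRel fun m n => value m = value n :=
  (PrimrecPred.and primrecRel_value_le (primrecRel_value_le.comp Primrec.snd Primrec.fst)).of_eq
    fun _ => le_antisymm_iff.symm

open Classical in
/-- The least code of an element. -/
noncomputable def code (f : Colex (KleeneBrouwer →₀ ℤ)) : ℕ := Nat.find (value_surjective f)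

open Classical in
theorem value_code (f : Colex (KleeneBrouwer →₀ ℤ)) : value (code f) = f :=
  Nat.find_spec (value_surjective f)

open Classical in
theorem code_value_le (m : ℕ) : code (value m) ≤ m := Nat.find_min' _ rfl

-- The least code is at most `m`, and its graph is decided by comparing `value m` with the values of
-- smaller codes.
open Classical in
theorem primrec_code_value : Primrec fun m => code (value m) := by
  refine Primrec.of_graph ⟨id, Primrec.id, code_value_le⟩ ?_
  have h1 : PrimrecRel fun c m : ℕ => ∀ c' ∈ List.range c, value c' ≠ value m :=
    (PrimrecRel.forall_mem_list primrecRel_value_eq.not).comp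
      (Primrec.list_range.comp Primrec.fst) Primrec.snd
  refine ((primrecRel_value_eq.comp Primrec.snd Primrec.fst).and
    (h1.comp Primrec.snd Primrec.fst)).of_eq fun p => ?_
  change _ ↔ Nat.find (value_surjective (value p.1)) = p.2
  rw [Nat.find_eq_iff]
  simp

/-- The code of a sum. -/
noncomputable def addCode (a b : ℕ) : ℕ := code (value a + value b)

theorem primrec₂_addCode : Primrec₂ addCode := by
  have h1 : Primrec fun p : ℕ × ℕ => ofNat FormalDiff p.1 := primrec_ofNat.comp Primrec.fst
  have h2 : Primrec fun p : ℕ × ℕ => ofNat FormalDiff p.2 := primrec_ofNat.comp Primrec.snd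
  have h : Primrec fun p : ℕ × ℕ => encode ((((ofNat FormalDiff p.1).1 ++ (ofNat FormalDiff p.2).1,
      (ofNat FormalDiff p.1).2 ++ (ofNat FormalDiff p.2).2)) : FormalDiff) :=
    Primrec.encode.comp (Primrec.pair
      (Primrec.list_append.comp (Primrec.fst.comp h1) (Primrec.fst.comp h2))
      (Primrec.list_append.comp (Primrec.snd.comp h1) (Primrec.snd.comp h2)))
  refine (primrec_code_value.comp h).of_eq fun p => ?_
  rw [addCode, value, ofNat_encode, toColex, coeff_append]
  rfl

end FormalDiff

/-! ### The ordered group of a tree -/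

namespace BaireTree

open FormalDiff

variable (T : BaireTree)

/-- The elements of `ℤ ^ KleeneBrouwer` supported on `T`. -/
noncomputable def supported : AddSubgroup (Colex (KleeneBrouwer →₀ ℤ)) where
  carrier := {f | ∀ k : List ℕ, ofColex f k ≠ 0 → k ∈ T.1}
  zero_mem' k h := absurd rfl h
  add_mem' {f g} hf hg k h := by
    by_contra hk
    have h1 : ofColex f k = 0 := not_not.1 (mt (hf k) hk)
    have h2 : ofColex g k = 0 := not_not.1 (mt (hg k) hk)
    refine h ?_
    change ofColex f k + ofColex g k = 0
    rw [h1, h2, add_zero]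
  neg_mem' {f} hf k h := hf k fun h' => h (by
    change -ofColex f k = 0
    rw [h', neg_zero])

theorem mem_supported {f : Colex (KleeneBrouwer →₀ ℤ)} :
    f ∈ T.supported ↔ ∀ k : List ℕ, ofColex f k ≠ 0 → k ∈ T.1 := Iff.rfl

/-- The set of least codes of the elements supported on `T`. -/
def groupCarrier : Set ℕ := {m | code (value m) = m ∧ value m ∈ T.supported}

/-- Least codes correspond to elements. -/
noncomputable def groupEquiv : T.groupCarrier ≃ Multiplicative T.supported where
  toFun m := Multiplicative.ofAdd ⟨value m, m.2.2⟩
  invFun f := ⟨code f.toAdd.1, by rw [value_code], by rw [value_code]; exact f.toAdd.2⟩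
  left_inv m := Subtype.ext m.2.1
  right_inv f := by
    refine Multiplicative.toAdd.injective (Subtype.ext ?_)
    exact value_code _

/-- The ordered group `ℤ ^ T`, where `T` carries the Kleene–Brouwer order. -/
noncomputable def orderedGroup : CountableOrderedGroup where
  carrier := T.groupCarrier
  group := T.groupEquiv.group
  order := LinearOrder.lift' (fun m => value m) fun m n h =>
    T.groupEquiv.injective (Multiplicative.toAdd.injective (Subtype.ext h))
  mul_right_le a b g h := by
    change value (code (value a + value g)) ≤ value (code (value b + value g))
    rw [value_code, value_code]
    exact add_le_add_left (show value a ≤ value b from h) _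
  mul_left_le a b g h := by
    change value (code (value g + value a)) ≤ value (code (value g + value b))
    rw [value_code, value_code]
    exact add_le_add_right (show value a ≤ value b from h) _

/-- The function denoted by a group element. -/
noncomputable def elemValue (g : T.orderedGroup.Elem) : Colex (KleeneBrouwer →₀ ℤ) :=
  value (show T.groupCarrier from g).1

theorem elemValue_mem (g : T.orderedGroup.Elem) : T.elemValue g ∈ T.supported :=
  (show T.groupCarrier from g).2.2

theorem elemValue_lt_iff {g h : T.orderedGroup.Elem} :
    T.elemValue g < T.elemValue h ↔ g < h := by
  rw [← not_le, ← not_le]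
  exact Iff.rfl

theorem exists_elemValue_eq {f : Colex (KleeneBrouwer →₀ ℤ)} (hf : f ∈ T.supported) :
    ∃ g, T.elemValue g = f :=
  ⟨(T.groupEquiv.symm (Multiplicative.ofAdd ⟨f, hf⟩) : T.groupCarrier), value_code f⟩

/-- Without a path, `T` is well-ordered by Kleene–Brouwer, and restricting functions to `T` embeds
the group into `ℤ ^ T`. -/
theorem scattered_orderedGroup (h : ¬ T.IllFounded) :
    Scattered (Set.univ : Set T.orderedGroup.Elem) := by
  let X : Type := {σ : KleeneBrouwer // (show List ℕ from σ) ∈ T.1}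
  have : WellFoundedLT X := by
    refine ⟨WellFounded.wellFounded_iff_has_min.2 fun S ⟨σ, hσ⟩ => ?_⟩
    by_contra! hn
    refine h (T.illFounded_iff.2 ⟨Subtype.val '' S, ⟨_, σ, hσ, rfl⟩, ?_, ?_⟩)
    · rintro _ ⟨τ, -, rfl⟩
      exact τ.2
    · rintro _ ⟨τ, hτ, rfl⟩
      obtain ⟨υ, hυ, hlt⟩ := hn τ hτ
      exact ⟨_, ⟨υ, hυ, rfl⟩, hlt⟩
  let r : T.orderedGroup.Elem → Colex (X →₀ ℤ) := fun g =>
    toColex (Finsupp.subtypeDomain _ (ofColex (T.elemValue g)))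
  refine (Scattered.colex_finsupp X).of_mapsTo r (fun g h hgh => ?_) (Set.mapsTo_univ _ _)
  obtain ⟨k, hk, hlt⟩ := Finsupp.colex_lt_iff.1 (T.elemValue_lt_iff.2 hgh)
  -- The two values differ at `k`, so one of them is nonzero there.
  have hkT : (show List ℕ from k) ∈ T.1 := by
    by_cases h0 : ofColex (T.elemValue g) k = 0
    · exact T.elemValue_mem h k (by omega)
    · exact T.elemValue_mem g k h0
  exact Finsupp.colex_lt_iff.2 ⟨⟨k, hkT⟩, fun j hj => hk j.1 hj, hlt⟩

/-- Let `S ⊆ T` be nonempty without least element. If `g < h` are supported on `S` and differ last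
at `k`, then `k ∈ S`, and adding `1` to `g` at some `τ < k` in `S` gives an element strictly
between. -/
theorem not_scattered_orderedGroup (h : T.IllFounded) :
    ¬ Scattered (Set.univ : Set T.orderedGroup.Elem) := by
  obtain ⟨S, ⟨σ₀, hσ₀⟩, hST, hS⟩ := T.illFounded_iff.1 h
  intro hsc
  let P : Colex (KleeneBrouwer →₀ ℤ) → Prop := fun f => ∀ k : List ℕ, ofColex f k ≠ 0 → k ∈ S
  have hP : ∀ f, P f → ∃ g, T.elemValue g = f := fun f hf =>
    T.exists_elemValue_eq fun k hk => hST k (hf k hk)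
  let δ : List ℕ → (KleeneBrouwer →₀ ℤ) := fun τ => Finsupp.single (show KleeneBrouwer from τ) 1
  have hδ : ∀ f τ, P f → τ ∈ S → P (toColex (ofColex f + δ τ)) := by
    intro f τ hf hτ k hk
    by_cases hkτ : k = τ
    · exact hkτ ▸ hτ
    · refine hf k fun h0 => hk ?_
      change ofColex f k + δ τ k = 0
      rw [h0, zero_add]
      exact Finsupp.single_eq_of_ne hkτ
  have hlt : ∀ f τ, f < toColex (ofColex f + δ τ) := by
    intro f τ
    refine Finsupp.colex_lt_iff.2 ⟨τ, fun b hb => ?_, ?_⟩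
    · change ofColex f b = ofColex f b + δ τ b
      rw [show δ τ b = 0 from Finsupp.single_eq_of_ne (ne_of_gt hb), add_zero]
    · change ofColex f τ < ofColex f τ + δ τ τ
      rw [show δ τ τ = 1 from Finsupp.single_eq_same]
      omega
  obtain ⟨g₀, hg₀⟩ := hP 0 fun k hk => absurd rfl hk
  obtain ⟨g₁, hg₁⟩ := hP _ (hδ 0 σ₀ (fun k hk => absurd rfl hk) hσ₀)
  have hne : g₀ < g₁ := T.elemValue_lt_iff.1 (by rw [hg₀, hg₁]; exact hlt _ _)
  obtain ⟨g, hg, h, hh, hgh, hn⟩ := hsc {g | P (T.elemValue g)} (Set.subset_univ _)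
    ⟨g₀, by
      change P (T.elemValue g₀)
      rw [hg₀]
      exact fun k hk => absurd rfl hk, g₁, by
      change P (T.elemValue g₁)
      rw [hg₁]
      exact hδ 0 σ₀ (fun k hk => absurd rfl hk) hσ₀, hne.ne⟩
  obtain ⟨k, hk, hklt⟩ := Finsupp.colex_lt_iff.1 (T.elemValue_lt_iff.2 hgh)
  have hkS : k ∈ S := by
    by_cases h0 : ofColex (T.elemValue g) k = 0
    · exact hh k (by omega)
    · exact hg k h0
  obtain ⟨τ, hτ, hτk⟩ := hS k hkS
  have hf := hδ _ τ hg hτ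
  obtain ⟨f, hf'⟩ := hP _ hf
  refine hn f (by change P (T.elemValue f); rwa [hf']) (T.elemValue_lt_iff.1 ?_)
    (T.elemValue_lt_iff.1 ?_)
  · rw [hf']
    exact hlt _ _
  · rw [hf']
    have hz : ∀ j : KleeneBrouwer, k ≤ j → δ τ j = 0 := fun j hj =>
      Finsupp.single_eq_of_ne (ne_of_gt (lt_of_lt_of_le hτk hj))
    refine Finsupp.colex_lt_iff.2 ⟨k, fun b hb => ?_, ?_⟩
    · change ofColex (T.elemValue g) b + δ τ b = _
      rw [hz b hb.le, add_zero, hk b hb]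
    · change ofColex (T.elemValue g) k + δ τ k < _
      rwa [hz k le_rfl, add_zero]

end BaireTree

/-- The test for membership in the group, reading the name of the tree from `ρ`. -/
def GroupTest (m : ℕ) (ρ : List ℕ) : Prop :=
  FormalDiff.code (FormalDiff.value m) = m ∧
    ∀ k ∈ (ofNat FormalDiff m).1 ++ (ofNat FormalDiff m).2,
      (ofNat FormalDiff m).1.count k = (ofNat FormalDiff m).2.count k ∨
        ρ.getD (encode k) 0 = 1

theorem primrecRel_groupTest : PrimrecRel GroupTest := by
  have hw : Primrec (ofNat FormalDiff) := FormalDiff.primrec_ofNat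
  have h1 : PrimrecRel fun (k : List ℕ) (p : ℕ × List ℕ) =>
      (ofNat FormalDiff p.1).1.count k = (ofNat FormalDiff p.1).2.count k ∨
        p.2.getD (encode k) 0 = 1 := by
    have hw' : Primrec fun q : List ℕ × ℕ × List ℕ => ofNat FormalDiff q.2.1 :=
      hw.comp (Primrec.fst.comp Primrec.snd)
    refine PrimrecPred.or (Primrec.eq.comp
      (Primrec.list_count.comp Primrec.fst (Primrec.fst.comp hw'))
      (Primrec.list_count.comp Primrec.fst (Primrec.snd.comp hw'))) ?_
    exact Primrec.eq.comp ((Primrec.list_getD 0).comp (Primrec.snd.comp Primrec.snd)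
      (Primrec.encode.comp Primrec.fst)) (Primrec.const 1)
  have hw' : Primrec fun q : ℕ × List ℕ => ofNat FormalDiff q.1 := hw.comp Primrec.fst
  exact PrimrecPred.and
    (Primrec.eq.comp (FormalDiff.primrec_code_value.comp Primrec.fst) Primrec.fst)
    (h1.forall_mem_list.comp
      (Primrec.list_append.comp (Primrec.fst.comp hw') (Primrec.snd.comp hw')) Primrec.id)

open Classical in
/-- The value at `n` of a name of the ordered group of a tree whose name begins with `ρ`. -/
noncomputable def groupName (n : ℕ) (ρ : List ℕ) : ℕ :=
  if n.unpair.1 = 0 then if GroupTest n.unpair.2 ρ then 1 else 0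
  else if n.unpair.1 = 1 then FormalDiff.addCode n.unpair.2.unpair.1 n.unpair.2.unpair.2
  else if FormalDiff.value n.unpair.2.unpair.1 ≤ FormalDiff.value n.unpair.2.unpair.2 then 1 else 0

theorem primrec₂_groupName : Primrec₂ groupName := by
  classical
  have h1 : Primrec fun p : ℕ × List ℕ => p.1.unpair.1 :=
    Primrec.fst.comp (Primrec.unpair.comp Primrec.fst)
  have h2 : Primrec fun p : ℕ × List ℕ => p.1.unpair.2 :=
    Primrec.snd.comp (Primrec.unpair.comp Primrec.fst)
  have ha : Primrec fun p : ℕ × List ℕ => p.1.unpair.2.unpair.1 :=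
    Primrec.fst.comp (Primrec.unpair.comp h2)
  have hb : Primrec fun p : ℕ × List ℕ => p.1.unpair.2.unpair.2 :=
    Primrec.snd.comp (Primrec.unpair.comp h2)
  exact Primrec.ite (Primrec.eq.comp h1 (Primrec.const 0))
    (Primrec.ite (primrecRel_groupTest.comp h2 Primrec.snd) (Primrec.const 1) (Primrec.const 0))
    (Primrec.ite (Primrec.eq.comp h1 (Primrec.const 1))
      (FormalDiff.primrec₂_addCode.comp ha hb)
      (Primrec.ite (FormalDiff.primrecRel_value_le.comp ha hb) (Primrec.const 1)
        (Primrec.const 0)))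

/-- Every string occurring in the formal difference with code `m` has a code below `m`, so the first
`l > m` values of the name answer all queries. -/
theorem groupTest_iff {p : ℕ → ℕ} {T : BaireTree} (hp : IsName p T) {m l : ℕ} (hl : m < l) :
    GroupTest m (initSeg p l) ↔ m ∈ T.groupCarrier := by
  refine and_congr_right fun _ => ?_
  rw [T.mem_supported]
  have hsub : ∀ k : List ℕ, ofColex (FormalDiff.value m) k =
      (ofNat FormalDiff m).1.count k - (ofNat FormalDiff m).2.count k := fun k =>
    FormalDiff.coeff_apply _ _
  have hm : encode (ofNat FormalDiff m) = m := encode_ofNat m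
  have hle : ∀ k ∈ (ofNat FormalDiff m).1 ++ (ofNat FormalDiff m).2, encode k < l := by
    intro k hk
    refine lt_of_lt_of_le ?_ hl.le
    conv_rhs => rw [← hm]
    rcases List.mem_append.1 hk with h | h
    · exact (le_encode_of_mem h).trans_le (Nat.left_le_pair _ _)
    · exact (le_encode_of_mem h).trans_le (Nat.right_le_pair _ _)
  have hp' : ∀ k : List ℕ, p (encode k) = 1 ↔ k ∈ T.1 := fun k => by
    have := hp k
    rw [this]
    simp
  constructor
  · intro h k hk
    rw [hsub] at hk
    have hkm : k ∈ (ofNat FormalDiff m).1 ++ (ofNat FormalDiff m).2 := by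
      by_contra hn
      rw [List.mem_append, not_or] at hn
      rw [List.count_eq_zero_of_not_mem hn.1, List.count_eq_zero_of_not_mem hn.2] at hk
      simp at hk
    rcases h k hkm with h | h
    · exact absurd (by rw [h, sub_self]) hk
    · rwa [getD_initSeg (hle k hkm), hp'] at h
  · intro h k hk
    rw [getD_initSeg (hle k hk), hp']
    by_cases hc : (ofNat FormalDiff m).1.count k = (ofNat FormalDiff m).2.count k
    · exact Or.inl hc
    · refine Or.inr (h k ?_)
      rw [hsub]
      omega

theorem isName_orderedGroup {p : ℕ → ℕ} {T : BaireTree} (hp : IsName p T) :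
    IsName (fun n => groupName n (initSeg p (n + 1))) T.orderedGroup := by
  classical
  refine ⟨fun m => ?_, fun a b => ?_, fun a b => ?_⟩
  · simp only [groupName, Nat.unpair_pair, if_true]
    -- `m ≤ Nat.pair 0 m`, so reading one value more than the output index is enough.
    rw [groupTest_iff hp (Nat.lt_succ_of_le (Nat.right_le_pair _ _))]
    rfl
  · simp only [groupName, Nat.unpair_pair, one_ne_zero, if_false, if_true]
    rfl
  · simp only [groupName, Nat.unpair_pair]
    rw [if_neg two_ne_zero, if_neg (by decide)]
    exact if_congr Iff.rfl rfl rfl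

theorem WF_le_OGToEps : WeihrauchLE WF OGToEps := by
  refine weihrauchLE_of_forward (fun p n => groupName n (initSeg p (n + 1)))
    (isComputableFunctional_of_bounded primrec₂_groupName Primrec.succ
      (fun m n h => Nat.succ_le_succ h))
    fun p T hp _ => ⟨T.orderedGroup, isName_orderedGroup hp, T.orderedGroup.mem_dom_OGToEps, ?_⟩
  classical
  intro ε hε
  rw [T.orderedGroup.mem_OGToEps_iff] at hε
  change ε = if T.IllFounded then 1 else 0
  rw [hε]
  by_cases h : T.IllFounded
  · rw [if_neg (T.not_scattered_orderedGroup h), if_pos h]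
  · rw [if_pos (T.scattered_orderedGroup h), if_neg h]

theorem mainTheorem5 :
    (∀ G : CountableOrderedGroup, ∃! ε, ε ∈ OGToEps G) ∧ WeihrauchEquiv OGToEps WF :=
  ⟨fun G => G.existsUnique_mem_OGToEps, OGToEps_le_WF, WF_le_OGToEps⟩
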